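/- Consider a MISO broadcast channel with $M\ge 1$ transmit antennas and $K=gG$ single-antenna users, in $G$ groups of $g$ users, $1\le G<K$ (so $g\ge 2$); group $i$ is $\mathcal K_i=\{(i-1)g+1,\dots,ig\}$. Let $\mathbf H=(\mathbf h_1,\dots,\mathbf h_K)$ be the random channel vectors in $\mathbb C^M$, with $\Gamma_k=\mathbb E\|\mathbf h_k\|^2<\infty$ and an absolutely continuous joint law that does not depend on the power $P$. At power $P\ge 1$ the transmitter knows estimates $\hat{\mathbf H}=(\hat{\mathbf h}_1,\dots,\hat{\mathbf h}_K)$ of finite second moment, with errors $\tilde{\mathbf h}_k=\mathbf h_k-\hat{\mathbf h}_k$, such that $\hat{\mathbf h}_k$ and $\tilde{\mathbf h}_k$ have zero mean and are uncorrelated, $\mathbb E\|\tilde{\mathbf h}_k\|^2=P^{-\alpha}\,\Gamma_k$ with $\alpha\in[0,1]$, and, for all large $P$ and all $k$, the conditional law of the normalized error $P^{\alpha/2}\tilde{\mathbf h}_k$ given $\hat{\mathbf H}$ has a density bounded by a constant that does not depend on $P$. A precoding policy at power $P$ is a measurable map $\hat{\mathbf H}\mapsto(\mathbf p_1,\dots,\mathbf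 p_K)\in(\mathbb C^M)^K$ with $\sum_k\|\mathbf p_k\|^2\le P$. With MISO NOMA (unit noise power, Gaussian signalling, successive interference cancellation), user $j\in\mathcal K_i$ decodes the messages of the users $k\in\mathcal K_i$, $k\ge j$, at the ergodic rates $$\bar R_{j,k}=\mathbb E\log_2\Big(1+\frac{|\mathbf h_j^H\mathbf p_k|^2}{1+\sum_{m\in\mathcal K_i,\,m<k}|\mathbf h_j^H\mathbf p_m|^2+\sum_{l\ne i}\sum_{m\in\mathcal K_l}|\mathbf h_j^H\mathbf p_m|^2}\Big),$$ the rate of user $k\in\mathcal K_i$ is $R_k=\min_{j\in\mathcal K_i,\,j\le k}\bar R_{j,k}$, and $R_{\mathrm s}(P)$ is the supremum of $\sum_{k=1}^K R_k$ over all precoding policies at power $P$. Then $R_{\mathrm s}(P)$ is finite for every $P\ge1$, and the sum multiplexing gain is $$d_{\mathrm s}=\lim_{P\to\infty}\frac{R_{\mathrm s}(P)}{\log_2 P}=\max\big(1,\min(M,G)\,\alpha\big).$$ Moreover there are precoding policies, one for each $P\ge1$, for which all the limits $d_k=\lim_{P\to\infty}R_k/\log_2 P$ exist and $\sum_{k=1}^K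 d_k=\max\big(1,\min(M,G)\,\alpha\big)$. -/

import Mathlib

open MeasureTheory Filter Topology
open scoped NNReal

/-- The `K = G * g` users, arranged in `G` groups of `g` users each. The pair `(i, a)` (both
counted from `0`) is the `(a + 1)`-st user of the `(i + 1)`-st group, so the "strong user" of group
`i`, which decodes all the messages of its group, is `(i, 0)`. -/
abbrev User (G g : ℕ) : Type := Fin G × Fin g

/-- One vector of `ℂ^M` (with the Euclidean norm) for each user: the channel vectors `h_k`, their
estimates, or the precoders `p_k`. -/
abbrev UserVectors (M G g : ℕ) : Type := User G g → EuclideanSpace ℂ (Fin M)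

/-- The power `|h_jᴴ p_m|²` that user `j` receives from stream `m`. (The inner product is
conjugate-linear in its first argument.) -/
noncomputable def rxPower {M G g : ℕ} (h p : UserVectors M G g) (j m : User G g) : ℝ :=
  ‖inner ℂ (h j) (p m)‖ ^ 2

/-- Intra-group interference at user `j` (of the same group as `k`) when it decodes stream `k`: the
streams of the users that come before `k` in the group. -/
noncomputable def intraInterference {M G g : ℕ} (h p : UserVectors M G g) (j k : User G g) : ℝ :=
  ∑ m ∈ Finset.univ.filter (fun m : Fin g => m < k.2), rxPower h p j (k.1, m)

/-- Inter-group interference at user `j` when it decodes stream `k`: the streams of all the other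
groups. -/
noncomputable def interInterference {M G g : ℕ} (h p : UserVectors M G g) (j k : User G g) : ℝ :=
  ∑ l ∈ Finset.univ.filter (fun l : Fin G => l ≠ k.1), ∑ m : Fin g, rxPower h p j (l, m)

/-- The rate `R_{j,k}` at which user `j` can decode the message of user `k` of its group, for the
channels `h` and the precoders `p`, with unit noise power. -/
noncomputable def decodingRate {M G g : ℕ} (h p : UserVectors M G g) (j k : User G g) : ℝ :=
  Real.logb 2 (1 + rxPower h p j k / (intraInterference h p j k + interInterference h p j k + 1))

/-- A precoding policy at power `P`: the precoders are a measurable function of the channel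
estimates, and the transmit power `∑ ‖p_k‖²` is at most `P`. -/
structure IsPrecodingPolicy {M G g : ℕ} (P : ℝ) (p : UserVectors M G g → UserVectors M G g) :
    Prop where
  measurable : Measurable p
  power_le : ∀ x, ∑ k, ‖p x k‖ ^ 2 ≤ P

section Rates

variable {Ω : Type*} [MeasurableSpace Ω] {M G g : ℕ}

/-- The ergodic rate at which user `j` can decode the message of user `k`. -/
noncomputable def ergodicDecodingRate (μ : Measure Ω) (H Hhat : Ω → UserVectors M G g)
    (p : UserVectors M G g → UserVectors M G g) (j k : User G g) : ℝ :=
  ∫ ω, decodingRate (H ω) (p (Hhat ω)) j k ∂μ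

/-- The ergodic NOMA rate of user `k`: its message has to be decoded by every user `j ≤ k` of its
group. -/
noncomputable def userRate (μ : Measure Ω) (H Hhat : Ω → UserVectors M G g)
    (p : UserVectors M G g → UserVectors M G g) (k : User G g) : ℝ :=
  (Finset.Iic k.2).inf' ⟨k.2, Finset.mem_Iic.2 le_rfl⟩
    (fun a => ergodicDecodingRate μ H Hhat p (k.1, a) k)

/-- The ergodic sum-rates that MISO NOMA achieves with power `P`. -/
def achievableSumRates (μ : Measure Ω) (H Hhat : Ω → UserVectors M G g) (P : ℝ) : Set ℝ :=
  {r | ∃ p : UserVectors M G g → UserVectors M G g,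
    IsPrecodingPolicy P p ∧ r = ∑ k, userRate μ H Hhat p k}

/-- The (best) ergodic sum-rate of MISO NOMA with power `P`. -/
noncomputable def maxSumRate (μ : Measure Ω) (H Hhat : Ω → UserVectors M G g) (P : ℝ) : ℝ :=
  sSup (achievableSumRates μ H Hhat P)

/-- The fading and CSIT model with quality parameter `α`. The channels `H` do not depend on the
transmit power `P`; the transmitter's estimate `Hhat P` does, and `H - Hhat P` is the estimation
error, whose variance normalized by `E ‖h_k‖²` is `P ^ (-α)`. -/
structure IsCSITModel (μ : Measure Ω) (α : ℝ) (H : Ω → UserVectors M G g)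
    (Hhat : ℝ → Ω → UserVectors M G g) : Prop where
  measurable_channel : Measurable H
  measurable_estimate : ∀ P, 1 ≤ P → Measurable (Hhat P)
  /-- Finite average channel gains `Γ_k = E ‖h_k‖²`. -/
  memLp_channel : ∀ k, MemLp (fun ω => H ω k) 2 μ
  memLp_estimate : ∀ P, 1 ≤ P → ∀ k, MemLp (fun ω => Hhat P ω k) 2 μ
  /-- The estimates have zero mean. -/
  mean_estimate : ∀ P, 1 ≤ P → ∀ k, ∫ ω, Hhat P ω k ∂μ = 0
  /-- The estimation errors have zero mean. -/
  mean_error : ∀ P, 1 ≤ P → ∀ k, ∫ ω, (H ω k - Hhat P ω k) ∂μ = 0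
  /-- Estimate and estimation error are uncorrelated. -/
  uncorrelated : ∀ P, 1 ≤ P → ∀ (k : User G g) (a b : Fin M),
    ∫ ω, Hhat P ω k a * (starRingEnd ℂ) (H ω k b - Hhat P ω k b) ∂μ = 0
  /-- The normalized error variance is `P ^ (-α)`. -/
  error_variance : ∀ P, 1 ≤ P → ∀ k,
    ∫ ω, ‖H ω k - Hhat P ω k‖ ^ 2 ∂μ = P ^ (-α) * ∫ ω, ‖H ω k‖ ^ 2 ∂μ
  /-- The joint distribution of all the channel coefficients has a density. -/
  absolutelyContinuous : μ.map H ≪ volume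
  /-- For large `P`, the normalized error of each user has, conditionally on the estimates, a
  density that is bounded uniformly in `P`. -/
  bounded_density : ∃ B : ℝ≥0, ∀ᶠ P : ℝ in atTop, ∀ k,
    μ.map (fun ω => (Hhat P ω, (P ^ (α / 2) : ℝ) • (H ω k - Hhat P ω k)))
      ≤ B • (μ.map (Hhat P)).prod volume

end Rates

/-!
On the scale of `log₂ P`, let the strongest stream of group `i` have power `P ^ xᵢ`, `xᵢ ≤ 1`.

*Converse.* The first user of a group decodes all the messages of the group, and by successive
decoding (`sum_decodingRate_eq`) their rates add up to that of a single message of the total power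
of the group, with only the other groups as interference. Two facts bound this interference from
below, outside an event whose probability is small uniformly in the policy. Since the
normalized error has a bounded density given the estimates, a stream of power `P ^ x` reaches every
user with at least the power `P ^ (x - α)`, up to a constant
(`IsCSITModel.exists_measureReal_rxPower_lt_le`; the geometric input is that thin slabs meet a ball
in a small volume, `exists_volume_slab_le`). Since the channels have a joint density, any `M` of
them are linearly independent, so that fewer than `M` users have a channel nearly orthogonal to a
given stream (`exists_forall_card_inner_lt`). All groups, except fewer than `M`, thus receive the
strongest of all streams at full strength, and can only have a bounded rate unless the strongest
stream is their own. This leaves at most `N = min M G` active groups, and with leakage exponents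
`(xⱼ - α)⁺` an elementary argument bounds their total rate by `max 1 (N α)`
(`sum_le_max_of_leakage`). The exceptional event costs an arbitrarily small multiple of `log₂ P`.

*Achievability.* The value `1` is attained by a fixed beam to one user. The value `N α` is attained
by zero-forcing to the first users of `N` groups, based on the estimates, with power of order
`P ^ α`: the leakage through the estimation error is then of the order of the noise, while the gain
of the beam for its own user stays away from `0`, as the estimates are close to the channels when
`α > 0`.
-/

/-! ### Volumes of slabs and vectors in general position -/

/-- Fubini's theorem for null sets: a measurable set all of whose slices in one coordinate direction
are null is null. -/
theorem volume_pi_eq_zero_of_slices {ι : Type*} [Fintype ι] [DecidableEq ι] {E : ι → Type*}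
    [∀ i, MeasureSpace (E i)] [∀ i, SigmaFinite (volume : Measure (E i))] {S : Set (∀ i, E i)}
    (hS : MeasurableSet S) (i : ι)
    (h : ∀ x, volume {v : E i | Function.update x i v ∈ S} = 0) : volume S = 0 := by
  have hm : Measurable (S.indicator (fun _ => (1 : ENNReal))) := measurable_const.indicator hS
  by_cases hne : S.Nonempty
  swap
  · rw [Set.not_nonempty_iff_eq_empty.1 hne]; simp
  obtain ⟨x, -⟩ := hne
  have h1 : ∫⁻ y, S.indicator (fun _ => (1 : ENNReal)) y
      ∂(Measure.pi fun i => (volume : Measure (E i))) = 0 := by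
    rw [lintegral_eq_lmarginal_univ x, lmarginal_erase' _ hm (Finset.mem_univ i)]
    have : (fun x => ∫⁻ v : E i, S.indicator (fun _ => (1 : ENNReal))
        (Function.update x i v)) = fun _ => 0 := by
      funext y
      have hmeas : MeasurableSet {v : E i | Function.update y i v ∈ S} :=
        hS.preimage (measurable_update y)
      have := lintegral_indicator_one (μ := (volume : Measure (E i))) hmeas
      rw [h y] at this
      rw [← this]
      rfl
    rw [this]
    simp [lmarginal]
  rw [lintegral_indicator hS] at h1
  simpa [volume_pi] using h1

theorem isOpen_setOf_linearIndependent_comp {ι κ E : Type*} [Fintype κ] [NormedAddCommGroup E]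
    [NormedSpace ℂ E] (e : κ → ι) :
    IsOpen {x : ι → E | LinearIndependent ℂ (fun a => x (e a))} :=
  (isOpen_setOfPred_linearIndependent (𝕜 := ℂ) (E := E) (ι := κ)).preimage
    (f := fun (x : ι → E) a => x (e a)) (by fun_prop)

/-- Vectors in general position: any fixed choice of at most `M` members of a family of vectors of
`ℂ^M` is linearly independent for almost every family. -/
theorem ae_linearIndependent_comp {ι : Type*} [Fintype ι] {M : ℕ} :
    ∀ {n : ℕ} (_ : n ≤ M) (e : Fin n → ι) (_ : Function.Injective e),
    ∀ᵐ x : ι → EuclideanSpace ℂ (Fin M), LinearIndependent ℂ (fun a => x (e a)) := by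
  classical
  intro n
  induction n with
  | zero => intro _ e _; exact Eventually.of_forall fun x => linearIndependent_empty_type
  | succ n ih =>
    intro hn e he
    have h1 := ih (by omega) (fun a => e a.castSucc) (he.comp (Fin.castSucc_injective n))
    -- The families whose last chosen vector lies in the span of the others, which are independent:
    -- the slices in the last chosen coordinate lie in a proper subspace.
    set S : Set (ι → EuclideanSpace ℂ (Fin M)) :=
      {x | LinearIndependent ℂ (fun a : Fin n => x (e a.castSucc))} \
      {x | LinearIndependent ℂ (fun a => x (e a))} with hSdef
    have hS : MeasurableSet S :=
      (isOpen_setOf_linearIndependent_comp (fun a : Fin n => e a.castSucc)).measurableSet.diff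
        (isOpen_setOf_linearIndependent_comp e).measurableSet
    have h2 : volume S = 0 := by
      refine volume_pi_eq_zero_of_slices hS (e (Fin.last n)) fun x => ?_
      set W : Submodule ℂ (EuclideanSpace ℂ (Fin M)) :=
        Submodule.span ℂ (Set.range fun a : Fin n => x (e a.castSucc)) with hW
      have hWtop : W.restrictScalars ℝ ≠ ⊤ := by
        intro htop
        have htop' : W = ⊤ := by
          rwa [Submodule.restrictScalars_eq_top_iff] at htop
        have hcard := finrank_range_le_card (R := ℂ) (fun a : Fin n => x (e a.castSucc))
        rw [Set.finrank, ← hW, htop', finrank_top, finrank_euclideanSpace] at hcard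
        simp at hcard
        omega
      refine measure_mono_null ?_ (Measure.addHaar_submodule volume _ hWtop)
      intro v hv
      obtain ⟨hv1, hv2⟩ := hv
      have key : (fun a : Fin n => Function.update x (e (Fin.last n)) v (e a.castSucc))
          = fun a => x (e a.castSucc) := by
        funext a
        exact Function.update_of_ne (fun h => (Fin.castSucc_lt_last a).ne (he h)) _ _
      simp only [Set.mem_ofPred_eq] at hv1 hv2
      rw [key] at hv1
      by_contra hvW
      refine hv2 ?_
      rw [linearIndependent_finSucc']
      refine ⟨?_, ?_⟩
      · have : Fin.init (fun a => Function.update x (e (Fin.last n)) v (e a))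
          = fun a : Fin n => x (e a.castSucc) := key
        rw [this]; exact hv1
      · have : Fin.init (fun a => Function.update x (e (Fin.last n)) v (e a))
          = fun a : Fin n => x (e a.castSucc) := key
        rw [this, Function.update_self]
        exact hvW
    filter_upwards [h1, measure_eq_zero_iff_ae_notMem.1 h2] with x hx1 hx2
    by_contra hx3
    exact hx2 ⟨hx1, hx3⟩

/-- A slab of small width meets a ball in a set of small volume, whatever its direction and
position: many disjoint translates of the intersection fit into a slightly larger ball. -/
theorem exists_volume_slab_le {E : Type*} [NormedAddCommGroup E] [InnerProductSpace ℂ E]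
    [MeasurableSpace E] [BorelSpace E] [ProperSpace E] (ν : Measure E) [ν.IsAddHaarMeasure]
    (R : ℝ) {η : ENNReal} (hη : η ≠ 0) :
    ∃ s : ℝ, 0 < s ∧ ∀ (u : E) (a : ℂ),
      ν {n | n ∈ Metric.closedBall 0 R ∧ ‖inner ℂ n u + a‖ < s * ‖u‖} ≤ η := by
  set V := ν (Metric.closedBall (0 : E) (R + 1)) with hV
  have hVt : V ≠ ⊤ := measure_closedBall_lt_top.ne
  obtain ⟨n, hn⟩ : ∃ n : ℕ, V / η < n := by
    exact ENNReal.exists_nat_gt (ENNReal.div_ne_top hVt hη)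
  have hnV : V ≤ n * η := by
    by_cases hηt : η = ⊤
    · rcases Nat.eq_zero_or_pos n with h0 | h0
      · subst h0; simp at hn
      · rw [hηt, ENNReal.mul_top (by exact_mod_cast h0.ne')]; exact le_top
    · exact (ENNReal.div_le_iff hη hηt).1 hn.le
  have hn0 : 0 < n := by
    rcases Nat.eq_zero_or_pos n with h0 | h0
    · subst h0; simp at hn
    · exact h0
  have hn0' : (0 : ℝ) < n := by exact_mod_cast hn0
  refine ⟨1 / (2 * n), by positivity, fun u a => ?_⟩
  set A := {x : E | x ∈ Metric.closedBall 0 R ∧ ‖inner ℂ x u + a‖ < 1 / (2 * n) * ‖u‖} with hA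
  by_cases hu : u = 0
  · have : A = ∅ := by
      ext x; simp [hA, hu]
    rw [this]; simp
  have hu' : 0 < ‖u‖ := norm_pos_iff.2 hu
  have hAm : MeasurableSet A := by
    refine MeasurableSet.inter Metric.isClosed_closedBall.measurableSet ?_
    exact (isOpen_lt
      (((continuous_id (X := E)).inner (𝕜 := ℂ) continuous_const).add continuous_const).norm
      continuous_const).measurableSet
  -- The shift by `t k` moves the value of the inner product by `k * ‖u‖ / n`, which is at least the
  -- full width of the slab for distinct `k`, while `‖t k‖ ≤ 1`.
  set t : ℕ → E := fun k => ((k / n / ‖u‖ : ℝ) : ℂ) • u with ht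
  have htu : ∀ k, inner ℂ (t k) u = ((k / n * ‖u‖ : ℝ) : ℂ) := by
    intro k
    simp only [ht, inner_smul_left, Complex.conj_ofReal, inner_self_eq_norm_sq_to_K]
    push_cast
    have : (‖u‖ : ℂ) ≠ 0 := by exact_mod_cast hu'.ne'
    simp only [Complex.coe_algebraMap]
    field_simp
  have hdisj : Pairwise (Function.onFun Disjoint fun k : Fin n => (fun x => -t k + x) ⁻¹' A) := by
    intro k l hkl
    rw [Function.onFun, Set.disjoint_left]
    intro x hx hy
    have hx2 := hx.2
    have hy2 := hy.2
    have hsub : ‖(inner ℂ (-t k + x) u + a) - (inner ℂ (-t l + x) u + a)‖ < 1 / n * ‖u‖ := by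
      refine (norm_sub_le _ _).trans_lt ((add_lt_add hx2 hy2).trans_eq ?_)
      field_simp; ring
    have heq : (inner ℂ (-t k + x) u + a) - (inner ℂ (-t l + x) u + a)
        = ((((l : ℝ) - k) / n * ‖u‖ : ℝ) : ℂ) := by
      simp only [inner_add_left, inner_neg_left, htu]
      push_cast; ring
    rw [heq, Complex.norm_real, Real.norm_eq_abs, abs_mul, abs_div, abs_norm, Nat.abs_cast] at hsub
    have h1 : (1 : ℝ) ≤ |(l : ℝ) - k| := by
      have : (1 : ℤ) ≤ |((l : ℕ) : ℤ) - ((k : ℕ) : ℤ)| := by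
        apply Int.one_le_abs
        intro h
        apply hkl; ext; omega
      exact_mod_cast this
    have : 1 / (n : ℝ) * ‖u‖ ≤ |(l : ℝ) - k| / n * ‖u‖ := by gcongr
    linarith
  have hsub : (⋃ k : Fin n, (fun x => -t k + x) ⁻¹' A) ⊆ Metric.closedBall 0 (R + 1) := by
    intro x hx
    obtain ⟨k, hk⟩ := Set.mem_iUnion.1 hx
    have hk1 : ‖-t k + x‖ ≤ R := by simpa using hk.1
    have htk : ‖t k‖ ≤ 1 := by
      simp only [ht, norm_smul, Complex.norm_real, Real.norm_eq_abs, abs_div, abs_norm,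
        Nat.abs_cast]
      rw [div_mul_cancel₀ _ hu'.ne', div_le_one hn0']
      exact_mod_cast k.2.le
    have : x = t k + (-t k + x) := by abel
    rw [mem_closedBall_zero_iff, this]
    linarith [norm_add_le (t k) (-t k + x)]
  have hsum : (n : ENNReal) * ν A ≤ V := by
    calc (n : ENNReal) * ν A = ∑ k : Fin n, ν ((fun x => -t k + x) ⁻¹' A) := by
          simp [measure_preimage_add]
      _ = ν (⋃ k : Fin n, (fun x => -t k + x) ⁻¹' A) := by
          rw [measure_iUnion hdisj fun k => hAm.preimage (measurable_const_add _), tsum_fintype]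
      _ ≤ V := measure_mono hsub
  have h3 := hsum.trans hnV
  exact (ENNReal.mul_le_mul_iff_right (by exact_mod_cast hn0.ne') (by simp)).1 h3

/-! ### Events of high probability -/

section Probability

variable {Ω : Type*} [MeasurableSpace Ω] {M G g : ℕ}

/-- Up to a small probability, the channels stay in a compact subset of any given open set of full
volume. -/
theorem exists_isCompact_measureReal_notMem_le {μ : Measure Ω} [IsProbabilityMeasure μ]
    {H : Ω → UserVectors M G g} (hH : Measurable H) (hac : μ.map H ≪ volume)
    {U : Set (UserVectors M G g)} (hU : IsOpen U) (hUae : ∀ᵐ x, x ∈ U) {δ : ℝ} (hδ : 0 < δ) :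
    ∃ K ⊆ U, IsCompact K ∧ μ.real {ω | H ω ∉ K} ≤ δ := by
  have := Measure.isProbabilityMeasure_map (μ := μ) hH.aemeasurable
  have hU1 : (μ.map H) U = 1 := (mem_ae_iff_prob_eq_one hU.measurableSet).1 (hac.ae_le hUae)
  obtain ⟨K, hKU, hK, hlt⟩ := hU.measurableSet.exists_isCompact_lt_add (μ := μ.map H)
    (measure_ne_top _ _) (ε := ENNReal.ofReal δ) (by simpa using hδ)
  refine ⟨K, hKU, hK, ?_⟩
  have hKm : MeasurableSet (H ⁻¹' K) := hH hK.measurableSet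
  rw [hU1, Measure.map_apply hH hK.measurableSet] at hlt
  have h2 : μ (H ⁻¹' K)ᶜ = 1 - μ (H ⁻¹' K) := prob_compl_eq_one_sub hKm
  have h3 : μ {ω | H ω ∉ K} ≤ ENNReal.ofReal δ := by
    change μ (H ⁻¹' K)ᶜ ≤ _
    rw [h2, tsub_le_iff_right, add_comm]
    exact hlt.le
  exact ENNReal.toReal_le_of_le_ofReal hδ.le h3

variable {μ : Measure Ω} {α : ℝ} {H : Ω → UserVectors M G g}
  {Hhat : ℝ → Ω → UserVectors M G g}

/-- Markov's inequality for the squared estimation error. -/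
theorem IsCSITModel.mul_measureReal_error_le [IsProbabilityMeasure μ]
    (hmodel : IsCSITModel μ α H Hhat) {P : ℝ} (hP : 1 ≤ P) (k : User G g) (t : ℝ) :
    t * μ.real {ω | t ≤ ‖H ω k - Hhat P ω k‖ ^ 2} ≤ P ^ (-α) * ∫ ω, ‖H ω k‖ ^ 2 ∂μ := by
  rw [← hmodel.error_variance P hP k]
  refine mul_meas_ge_le_integral_of_nonneg (Eventually.of_forall fun ω => by positivity) ?_ t
  exact ((hmodel.memLp_channel k).sub (hmodel.memLp_estimate P hP k)).integrable_norm_pow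
    (by norm_num)

theorem measurable_inner_user {f h : Ω → UserVectors M G g} (hf : Measurable f)
    (hh : Measurable h) (j m : User G g) :
    Measurable fun ω => (inner ℂ (f ω j) (h ω m) : ℂ) := by
  have h1 : Measurable fun ω => f ω j := (measurable_pi_apply j).comp hf
  have h2 : Measurable fun ω => h ω m := (measurable_pi_apply m).comp hh
  exact h1.inner h2

/-- The transmitter cannot steer a stream away from a user more precisely than its channel
knowledge permits: up to a small probability, which is uniform in the policy, each user receives
each stream with at least the power `s * P ^ (-α) * ‖p_m‖ ^ 2`. -/
theorem IsCSITModel.exists_measureReal_rxPower_lt_le [IsProbabilityMeasure μ]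
    (hmodel : IsCSITModel μ α H Hhat) {δ : ℝ} (hδ : 0 < δ) :
    ∃ s : ℝ, 0 < s ∧ s ≤ 1 ∧ ∀ᶠ P in atTop,
      ∀ p : UserVectors M G g → UserVectors M G g, Measurable p → ∀ j m : User G g,
        μ.real {ω | rxPower (H ω) (p (Hhat P ω)) j m
          < s * P ^ (-α) * ‖p (Hhat P ω) m‖ ^ 2} ≤ δ := by
  obtain ⟨B, hB⟩ := hmodel.bounded_density
  set Γ : ℝ := ∑ k, ∫ ω, ‖H ω k‖ ^ 2 ∂μ with hΓ
  have hΓ0 : ∀ k, 0 ≤ ∫ ω, ‖H ω k‖ ^ 2 ∂μ := fun k => integral_nonneg fun ω => by positivity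
  have hΓk : ∀ k, ∫ ω, ‖H ω k‖ ^ 2 ∂μ ≤ Γ := fun k =>
    Finset.single_le_sum (f := fun k => ∫ ω, ‖H ω k‖ ^ 2 ∂μ) (fun k _ => hΓ0 k)
      (Finset.mem_univ k)
  have hΓ' : 0 ≤ Γ := Finset.sum_nonneg fun k _ => hΓ0 k
  set R : ℝ := Real.sqrt ((Γ + 1) / (δ / 2)) with hR
  have hR2 : R ^ 2 = (Γ + 1) / (δ / 2) := Real.sq_sqrt (by positivity)
  have hRpos : 0 < R := Real.sqrt_pos.2 (by positivity)
  set η : ENNReal := ENNReal.ofReal (δ / 2 / (B + 1)) with hη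
  have hη0 : η ≠ 0 := by
    simp only [hη, ne_eq, ENNReal.ofReal_eq_zero, not_le]; positivity
  obtain ⟨s, hs, hslab⟩ := exists_volume_slab_le (E := EuclideanSpace ℂ (Fin M)) volume R hη0
  refine ⟨min 1 (s ^ 2), by positivity, min_le_left _ _, ?_⟩
  filter_upwards [hB, eventually_ge_atTop (1 : ℝ)] with P hBP hP p hp j m
  have hP0 : 0 < P := by linarith
  set c : ℝ := P ^ (α / 2) with hc
  have hc0 : 0 < c := Real.rpow_pos_of_pos hP0 _
  have hc2 : c ^ 2 * P ^ (-α) = 1 := by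
    rw [hc, ← Real.rpow_natCast, ← Real.rpow_mul hP0.le, ← Real.rpow_add hP0]
    norm_num
  have hHh := hmodel.measurable_estimate P hP
  have hH := hmodel.measurable_channel
  set N : Ω → EuclideanSpace ℂ (Fin M) := fun ω => c • (H ω j - Hhat P ω j) with hN
  have hNm : Measurable N :=
    (((measurable_pi_apply j).comp hH).sub ((measurable_pi_apply j).comp hHh)).const_smul c
  -- The slab, in terms of the estimates and the normalized error, of direction and position
  -- determined by the estimates alone.
  set T : Set (UserVectors M G g × EuclideanSpace ℂ (Fin M)) :=
    {z | z.2 ∈ Metric.closedBall 0 R ∧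
      ‖inner ℂ z.2 (p z.1 m) + (c : ℂ) * inner ℂ (z.1 j) (p z.1 m)‖ < s * ‖p z.1 m‖} with hT
  have hpm : Measurable fun z : UserVectors M G g × EuclideanSpace ℂ (Fin M) => p z.1 m :=
    (measurable_pi_apply m).comp (hp.comp measurable_fst)
  have hTm : MeasurableSet T := by
    refine MeasurableSet.inter (measurable_snd Metric.isClosed_closedBall.measurableSet) ?_
    refine measurableSet_lt (Measurable.norm ?_) (hpm.norm.const_mul s)
    refine (measurable_snd.inner hpm).add (Measurable.const_mul ?_ _)
    exact ((measurable_pi_apply j).comp measurable_fst).inner hpm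
  -- Either the normalized error is large, which Markov's inequality makes unlikely, or it is in the
  -- part of the slab in a ball, where the bounded conditional density applies.
  have hsub : {ω | rxPower (H ω) (p (Hhat P ω)) j m
          < min 1 (s ^ 2) * P ^ (-α) * ‖p (Hhat P ω) m‖ ^ 2}
      ⊆ {ω | R ^ 2 * P ^ (-α) ≤ ‖H ω j - Hhat P ω j‖ ^ 2} ∪
        (fun ω => (Hhat P ω, N ω)) ⁻¹' T := by
    intro ω hω
    by_cases hle : ‖N ω‖ ≤ R
    · right
      refine ⟨by simpa using hle, ?_⟩
      have h1 : inner ℂ (N ω) (p (Hhat P ω) m) + (c : ℂ) * inner ℂ (Hhat P ω j) (p (Hhat P ω) m)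
          = (c : ℂ) * inner ℂ (H ω j) (p (Hhat P ω) m) := by
        have : N ω = (c : ℂ) • (H ω j - Hhat P ω j) := by
          simp only [hN, Complex.coe_smul]
        rw [this, inner_smul_left, inner_sub_left, Complex.conj_ofReal]; ring
      simp only [h1]
      refine lt_of_pow_lt_pow_left₀ 2 (by positivity) ?_
      rw [norm_mul, Complex.norm_real, Real.norm_of_nonneg hc0.le, mul_pow, mul_pow]
      have h2 : rxPower (H ω) (p (Hhat P ω)) j m
          < s ^ 2 * P ^ (-α) * ‖p (Hhat P ω) m‖ ^ 2 :=
        lt_of_lt_of_le hω (by gcongr; exact min_le_right _ _)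
      calc c ^ 2 * ‖inner ℂ (H ω j) (p (Hhat P ω) m)‖ ^ 2
          < c ^ 2 * (s ^ 2 * P ^ (-α) * ‖p (Hhat P ω) m‖ ^ 2) :=
            mul_lt_mul_of_pos_left h2 (by positivity)
        _ = c ^ 2 * P ^ (-α) * (s ^ 2 * ‖p (Hhat P ω) m‖ ^ 2) := by ring
        _ = s ^ 2 * ‖p (Hhat P ω) m‖ ^ 2 := by rw [hc2, one_mul]
    · left
      have h1 : R ^ 2 ≤ c ^ 2 * ‖H ω j - Hhat P ω j‖ ^ 2 := by
        have : ‖N ω‖ = c * ‖H ω j - Hhat P ω j‖ := by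
          rw [hN]; simp only [norm_smul, Real.norm_of_nonneg hc0.le]
        rw [← mul_pow, ← this]
        exact pow_le_pow_left₀ hRpos.le (not_le.1 hle).le 2
      calc R ^ 2 * P ^ (-α) ≤ c ^ 2 * ‖H ω j - Hhat P ω j‖ ^ 2 * P ^ (-α) := by gcongr
        _ = c ^ 2 * P ^ (-α) * ‖H ω j - Hhat P ω j‖ ^ 2 := by ring
        _ = _ := by rw [hc2, one_mul]
  have htail : μ.real {ω | R ^ 2 * P ^ (-α) ≤ ‖H ω j - Hhat P ω j‖ ^ 2} ≤ δ / 2 := by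
    have h1 := hmodel.mul_measureReal_error_le hP j (R ^ 2 * P ^ (-α))
    have hPα : 0 < P ^ (-α) := Real.rpow_pos_of_pos hP0 _
    set x := μ.real {ω | R ^ 2 * P ^ (-α) ≤ ‖H ω j - Hhat P ω j‖ ^ 2}
    have h2 : R ^ 2 * x ≤ Γ + 1 := by
      have h3 : P ^ (-α) * (R ^ 2 * x) ≤ P ^ (-α) * ∫ ω, ‖H ω j‖ ^ 2 ∂μ := by
        calc _ = R ^ 2 * P ^ (-α) * x := by ring
          _ ≤ _ := h1
      linarith [le_of_mul_le_mul_left h3 hPα, hΓk j]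
    rw [hR2, div_mul_eq_mul_div, div_le_iff₀ (by positivity)] at h2
    exact le_of_mul_le_mul_left h2 (by positivity)
  have hhatprob := Measure.isProbabilityMeasure_map (μ := μ) hHh.aemeasurable
  have hTμ : μ.real ((fun ω => (Hhat P ω, N ω)) ⁻¹' T) ≤ δ / 2 := by
    refine ENNReal.toReal_le_of_le_ofReal (by positivity) ?_
    have h1 : μ ((fun ω => (Hhat P ω, N ω)) ⁻¹' T)
        ≤ (B • (μ.map (Hhat P)).prod (volume : Measure (EuclideanSpace ℂ (Fin M)))) T := by
      rw [← Measure.map_apply (hHh.prodMk hNm) hTm]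
      exact hBP j T
    refine h1.trans ?_
    have h2 : ((μ.map (Hhat P)).prod (volume : Measure (EuclideanSpace ℂ (Fin M)))) T ≤ η := by
      rw [Measure.prod_apply hTm]
      calc ∫⁻ y, volume (Prod.mk y ⁻¹' T) ∂(μ.map (Hhat P))
          ≤ ∫⁻ _, η ∂(μ.map (Hhat P)) := by
            refine lintegral_mono fun y => ?_
            exact hslab (p y m) ((c : ℂ) * inner ℂ (y j) (p y m))
        _ = η := by simp
    rw [Measure.smul_apply, ENNReal.smul_def, smul_eq_mul]
    calc (B : ENNReal) * _ ≤ (B : ENNReal) * η := by gcongr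
      _ = ENNReal.ofReal (B * (δ / 2 / (B + 1))) := by
          rw [hη, ENNReal.ofReal_mul (by positivity), ENNReal.ofReal_coe_nnreal]
      _ ≤ ENNReal.ofReal (δ / 2) := by
          refine ENNReal.ofReal_le_ofReal ?_
          rw [mul_div_assoc', div_le_iff₀ (by positivity)]
          nlinarith
  calc _ ≤ _ := measureReal_mono hsub
    _ ≤ _ := measureReal_union_le _ _
    _ ≤ δ := by linarith

end Probability

/-! ### The converse for one channel realization -/

/-- Successive decoding: the rates of the streams of one group add up to the rate of all of them
together. -/
theorem sum_logb_one_add_div_eq {n : ℕ} (S : Fin n → ℝ) (hS : ∀ a, 0 ≤ S a) {J : ℝ} (hJ : 0 < J) :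
    ∑ k, Real.logb 2 (1 + S k / (∑ m ∈ Finset.univ.filter (fun m => m < k), S m + J))
      = Real.logb 2 (1 + (∑ m, S m) / J) := by
  induction n with
  | zero => simp
  | succ n ih =>
    have hsum : ∀ k : Fin n, ∑ m ∈ Finset.univ.filter (fun m => m < k.castSucc), S m
        = ∑ m ∈ Finset.univ.filter (fun m => m < k), S m.castSucc := by
      intro k
      rw [Finset.sum_filter, Finset.sum_filter, Fin.sum_univ_castSucc]
      simp [Fin.le_last, not_lt]
    have hlast : ∑ m ∈ Finset.univ.filter (fun m => m < Fin.last n), S m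
        = ∑ m : Fin n, S m.castSucc := by
      rw [Finset.sum_filter, Fin.sum_univ_castSucc]
      simp [Fin.castSucc_lt_last]
    rw [Fin.sum_univ_castSucc, Fin.sum_univ_castSucc]
    simp only [hsum, hlast]
    rw [ih (fun m => S m.castSucc) (fun a => hS _)]
    have h0 : 0 ≤ ∑ m : Fin n, S m.castSucc := Finset.sum_nonneg fun m _ => hS _
    have h1 := hS (Fin.last n)
    rw [← Real.logb_mul (by positivity) (by positivity)]
    congr 1
    field_simp
    ring

section Deterministic

variable {M G g : ℕ}

theorem rxPower_nonneg (h p : UserVectors M G g) (j m : User G g) : 0 ≤ rxPower h p j m :=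
  sq_nonneg _

theorem rxPower_le (h p : UserVectors M G g) (j m : User G g) :
    rxPower h p j m ≤ ‖h j‖ ^ 2 * ‖p m‖ ^ 2 := by
  rw [rxPower, ← mul_pow]
  exact pow_le_pow_left₀ (norm_nonneg _) (norm_inner_le_norm _ _) 2

theorem intraInterference_nonneg (h p : UserVectors M G g) (j k : User G g) :
    0 ≤ intraInterference h p j k :=
  Finset.sum_nonneg fun _ _ => rxPower_nonneg _ _ _ _

theorem interInterference_nonneg (h p : UserVectors M G g) (j k : User G g) :
    0 ≤ interInterference h p j k :=
  Finset.sum_nonneg fun _ _ => Finset.sum_nonneg fun _ _ => rxPower_nonneg _ _ _ _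

theorem rxPower_le_interInterference (h p : UserVectors M G g) (j k m : User G g)
    (hm : m.1 ≠ k.1) : rxPower h p j m ≤ interInterference h p j k := by
  refine le_trans ?_ (Finset.single_le_sum
    (f := fun l => ∑ m : Fin g, rxPower h p j (l, m))
    (fun l _ => Finset.sum_nonneg fun _ _ => rxPower_nonneg _ _ _ _)
    (Finset.mem_filter.2 ⟨Finset.mem_univ m.1, hm⟩))
  exact Finset.single_le_sum (f := fun a => rxPower h p j (m.1, a))
    (fun a _ => rxPower_nonneg _ _ _ _) (Finset.mem_univ m.2)

theorem logb_two_mono {x y : ℝ} (hx : 0 < x) (hxy : x ≤ y) : Real.logb 2 x ≤ Real.logb 2 y :=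
  Real.logb_le_logb_of_le (by norm_num) hx hxy

theorem logb_two_one_add_nonneg {x : ℝ} (hx : 0 ≤ x) : 0 ≤ Real.logb 2 (1 + x) :=
  Real.logb_nonneg (by norm_num) (by linarith)

theorem decodingRate_nonneg (h p : UserVectors M G g) (j k : User G g) :
    0 ≤ decodingRate h p j k := by
  have h1 := intraInterference_nonneg h p j k
  have h2 := interInterference_nonneg h p j k
  have h3 := rxPower_nonneg h p j k
  exact logb_two_one_add_nonneg (by positivity)

theorem decodingRate_le_logb_rxPower (h p : UserVectors M G g) (j k : User G g) :
    decodingRate h p j k ≤ Real.logb 2 (1 + rxPower h p j k) := by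
  have h1 := intraInterference_nonneg h p j k
  have h2 := interInterference_nonneg h p j k
  have h3 := rxPower_nonneg h p j k
  refine logb_two_mono (by positivity) ?_
  have := div_le_self h3 (by linarith : 1 ≤ intraInterference h p j k + interInterference h p j k + 1)
  linarith

theorem logb_two_one_add_le {x : ℝ} (hx : 0 ≤ x) : Real.logb 2 (1 + x) ≤ x / Real.log 2 := by
  have h2 : 0 < Real.log 2 := Real.log_pos (by norm_num)
  rw [Real.logb]
  gcongr
  linarith [Real.log_le_sub_one_of_pos (by linarith : 0 < 1 + x)]

theorem logb_two_one_add_mul_le {P x : ℝ} (hP : 1 ≤ P) (hx : 0 ≤ x) :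
    Real.logb 2 (1 + P * x) ≤ Real.logb 2 P + Real.logb 2 (1 + x) := by
  rw [← Real.logb_mul (by positivity) (by positivity)]
  exact logb_two_mono (by positivity) (by nlinarith)

/-- The sum rate of the messages of one group, as decoded by one of its users. -/
theorem sum_decodingRate_eq (h p : UserVectors M G g) (j : User G g) (i : Fin G) (b : Fin g) :
    ∑ a, decodingRate h p j (i, a)
      = Real.logb 2 (1 + (∑ a, rxPower h p j (i, a)) / (interInterference h p j (i, b) + 1)) := by
  rw [← sum_logb_one_add_div_eq (fun a => rxPower h p j (i, a)) (fun a => rxPower_nonneg _ _ _ _)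
    (by linarith [interInterference_nonneg h p j (i, b)])]
  refine Finset.sum_congr rfl fun a _ => ?_
  rw [decodingRate, add_assoc]
  rfl

theorem sum_decodingRate_le_logb {P : ℝ} (hP : 1 ≤ P) (h p : UserVectors M G g)
    (hp : ∑ k, ‖p k‖ ^ 2 ≤ P) (j : User G g) (i : Fin G) (b : Fin g) :
    ∑ a, decodingRate h p j (i, a) ≤ Real.logb 2 P + Real.logb 2 (1 + ‖h j‖ ^ 2) := by
  refine le_trans ?_ (logb_two_one_add_mul_le hP (sq_nonneg _))
  rw [sum_decodingRate_eq h p j i b]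
  have h0 : 0 ≤ ∑ a, rxPower h p j (i, a) := Finset.sum_nonneg fun a _ => rxPower_nonneg _ _ _ _
  have h1 := interInterference_nonneg h p j (i, b)
  refine logb_two_mono (by positivity) ?_
  have h2 := div_le_self h0 (by linarith : 1 ≤ interInterference h p j (i, b) + 1)
  have h3 : ∑ a, ‖p (i, a)‖ ^ 2 ≤ P := by
    refine le_trans ?_ hp
    rw [Fintype.sum_prod_type]
    exact Finset.single_le_sum (f := fun i => ∑ a, ‖p (i, a)‖ ^ 2)
      (fun i _ => Finset.sum_nonneg fun a _ => sq_nonneg _) (Finset.mem_univ i)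
  have h4 : ∑ a, rxPower h p j (i, a) ≤ P * ‖h j‖ ^ 2 := by
    calc _ ≤ ∑ a, ‖h j‖ ^ 2 * ‖p (i, a)‖ ^ 2 := Finset.sum_le_sum fun a _ => rxPower_le _ _ _ _
      _ = (∑ a, ‖p (i, a)‖ ^ 2) * ‖h j‖ ^ 2 := by rw [← Finset.mul_sum, mul_comm]
      _ ≤ _ := by gcongr
  linarith

/-- A rate bound on the logarithmic scale: a signal of power at most `2 ^ x` against interference
of power at least `2 ^ y`, both up to constant factors, supports a rate of about `(x - y)⁺`. -/
theorem logb_two_one_add_mul_div_le {A τ J D y : ℝ} (hA : 0 ≤ A) (hτ : 0 ≤ τ) (hJ : 0 < J)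
    (hD : 1 ≤ D) (hy : 2 ^ y ≤ D * J) :
    Real.logb 2 (1 + A * τ / J) ≤ Real.logb 2 (1 + A) + 1 + Real.logb 2 D
      + max 0 (Real.logb 2 (max 1 τ) - y) := by
  set x := Real.logb 2 (max 1 τ) with hx
  have hmax : 0 < max 1 τ := by positivity
  have hx2 : (2 : ℝ) ^ x = max 1 τ := Real.rpow_logb (by norm_num) (by norm_num) hmax
  have h2y : (0 : ℝ) < 2 ^ y := Real.rpow_pos_of_pos (by norm_num) y
  set e := max 0 (x - y) with he
  have h2e : (2 : ℝ) ^ e = max 1 (2 ^ (x - y)) := by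
    rw [he, (Real.monotone_rpow_of_base_ge_one (by norm_num : (1 : ℝ) ≤ 2)).map_max]; simp
  have h1 : τ / J ≤ D * 2 ^ (x - y) := by
    rw [Real.rpow_sub (by norm_num), hx2, div_le_iff₀ hJ, mul_div_assoc', div_mul_eq_mul_div,
      le_div_iff₀ h2y]
    calc τ * 2 ^ y ≤ max 1 τ * (D * J) := by gcongr; exact le_max_right _ _
      _ = D * max 1 τ * J := by ring
  have h2 : 1 + A * τ / J ≤ (1 + A) * 2 * D * 2 ^ e := by
    have h3 : (1 : ℝ) ≤ 2 ^ e := h2e ▸ le_max_left _ _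
    have h4 : (2 : ℝ) ^ (x - y) ≤ 2 ^ e := h2e ▸ le_max_right _ _
    have h5 : τ / J ≤ D * 2 ^ e := h1.trans (by gcongr)
    have h6 : 1 ≤ D * 2 ^ e := one_le_mul_of_one_le_of_one_le hD h3
    have h7 : 0 ≤ τ / J := by positivity
    rw [mul_div_assoc]
    nlinarith
  calc _ ≤ Real.logb 2 ((1 + A) * 2 * D * 2 ^ e) := logb_two_mono (by positivity) h2
    _ = _ := by
      rw [Real.logb_mul (by positivity) (by positivity), Real.logb_mul (by positivity)
        (by positivity), Real.logb_mul (by positivity) (by positivity),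
        Real.logb_rpow (by norm_num) (by norm_num), Real.logb_self_eq_one (by norm_num)]

/-- The power allocation game on the logarithmic scale: with powers `x i ≤ L` and leakage reduced by
`b`, at most `N` active groups reach together at most `max L (N * b)`. Of two active groups, the one
with the largest power and any other reach together at most `2 * b`, and each further one at most
`b`. -/
theorem sum_le_max_of_leakage {ι : Type*} [Fintype ι] [DecidableEq ι] {x r : ι → ℝ} {L b : ℝ}
    {l : ι} {A : Finset ι} {N : ℕ} (hb : 0 ≤ b) (hx0 : ∀ i, 0 ≤ x i) (hxL : x l ≤ L)
    (hl : ∀ i, x i ≤ x l) (hA : A.card ≤ N) (hlA : l ∈ A) (hrA : ∀ i ∉ A, r i ≤ 0)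
    (hrl : r l ≤ x l) (hr : ∀ i j, i ≠ j → r i ≤ max 0 (x i - max 0 (x j - b))) :
    ∑ i, r i ≤ max L (N * b) := by
  by_cases hcase : ∀ i, i ≠ l → r i ≤ 0
  · refine le_max_of_le_left ?_
    rw [← Finset.add_sum_erase _ _ (Finset.mem_univ l)]
    have : ∑ i ∈ Finset.univ.erase l, r i ≤ 0 :=
      Finset.sum_nonpos fun i hi => hcase i (Finset.ne_of_mem_erase hi)
    linarith
  · push Not at hcase
    obtain ⟨k, hkl, hk⟩ := hcase
    refine le_max_of_le_right ?_
    have hkA : k ∈ A.erase l := by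
      refine Finset.mem_erase.2 ⟨hkl, ?_⟩
      by_contra h
      exact absurd (hrA k h) (not_le.2 hk)
    have h1 : ∑ i, r i ≤ ∑ i ∈ A, r i := by
      rw [← Finset.sum_add_sum_compl A]
      have : ∑ i ∈ Aᶜ, r i ≤ 0 :=
        Finset.sum_nonpos fun i hi => hrA i (Finset.mem_compl.1 hi)
      linarith
    have h2 : r l + r k ≤ 2 * b := by
      have h3 := hr k l hkl
      have h4 := hr l k hkl.symm
      have h5 := hl k
      have h6 := hx0 k
      have h7 := hx0 l
      have h8 : r k ≤ x k - max 0 (x l - b) := by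
        rcases le_max_iff.1 h3 with h | h
        · linarith
        · exact h
      have h9 : x k ≤ max 0 (x k - b) + b := by
        linarith [le_max_right 0 (x k - b)]
      have h10 : x l ≤ max 0 (x l - b) + b := by
        linarith [le_max_right 0 (x l - b)]
      rcases le_max_iff.1 h4 with h | h <;> linarith
    have h3 : ∀ i ∈ (A.erase l).erase k, r i ≤ b := by
      intro i hi
      have hil : i ≠ l := Finset.ne_of_mem_erase (Finset.mem_of_mem_erase hi)
      refine (hr i l hil).trans (max_le hb ?_)
      linarith [le_max_right 0 (x l - b), hl i]
    have h4 := Finset.sum_le_card_nsmul _ _ _ h3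
    rw [← Finset.add_sum_erase _ _ hlA, ← Finset.add_sum_erase _ _ hkA] at h1
    have h5 : ((A.erase l).erase k).card + 2 ≤ N := by
      have h6 := Finset.card_erase_add_one hlA
      have h7 := Finset.card_erase_add_one hkA
      omega
    have h5' : (((A.erase l).erase k).card : ℝ) + 2 ≤ N := by exact_mod_cast h5
    rw [nsmul_eq_mul] at h4
    nlinarith

/-- The converse for one channel realization, in which no channel is too large, every direction is
received well by all but fewer than `M` of the groups, and no stream is hidden from any user beyond
the precision `P ^ (-α)` of the channel knowledge. -/
theorem sum_decodingRate_le {α P R c s : ℝ} (hP : 1 ≤ P) (hα0 : 0 ≤ α)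
    (hc : 0 < c) (hs : 0 < s) (hs1 : s ≤ 1) (hG : 1 ≤ G)
    {h p : UserVectors M G g} (z : Fin g) (hp : ∑ k, ‖p k‖ ^ 2 ≤ P)
    (hR : ∀ i, ‖h (i, z)‖ ≤ R)
    (hcond : ∀ v, (Finset.univ.filter fun i : Fin G =>
      ‖(inner ℂ (h (i, z)) v : ℂ)‖ < c * ‖v‖).card < M)
    (hleak : ∀ j m, s * P ^ (-α) * ‖p m‖ ^ 2 ≤ rxPower h p j m) :
    ∑ i, ∑ a, decodingRate h p (i, z) (i, a)
      ≤ max 1 (((min M G : ℕ) : ℝ) * α) * Real.logb 2 P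
        + G * (Real.logb 2 (1 + g * R ^ 2) + 1 + Real.logb 2 (max s⁻¹ (c ^ 2)⁻¹)) := by
  classical
  have hP0 : 0 < P := by linarith
  set L := Real.logb 2 P with hL
  have hL0 : 0 ≤ L := Real.logb_nonneg (by norm_num) hP
  set D := max s⁻¹ (c ^ 2)⁻¹ with hD
  have hD1 : 1 ≤ D := le_max_of_le_left ((one_le_inv₀ hs).2 hs1)
  set C := Real.logb 2 (1 + g * R ^ 2) + 1 + Real.logb 2 D with hC
  have hex : ∀ i : Fin G, ∃ a : Fin g, ∀ b, ‖p (i, b)‖ ^ 2 ≤ ‖p (i, a)‖ ^ 2 := by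
    intro i
    obtain ⟨a, -, ha⟩ := Finset.exists_max_image Finset.univ (fun a : Fin g => ‖p (i, a)‖ ^ 2)
      ⟨z, Finset.mem_univ z⟩
    exact ⟨a, fun b => ha b (Finset.mem_univ b)⟩
  choose a ha using hex
  -- `τ i` is the power of the strongest stream of group `i`, and `l` the group with the largest one.
  set τ : Fin G → ℝ := fun i => ‖p (i, a i)‖ ^ 2 with hτ
  have hτ0 : ∀ i, 0 ≤ τ i := fun i => sq_nonneg _
  have hτP : ∀ i, τ i ≤ P := fun i => le_trans
    (Finset.single_le_sum (f := fun k => ‖p k‖ ^ 2) (fun k _ => sq_nonneg _)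
      (Finset.mem_univ (i, a i))) hp
  obtain ⟨l, -, hl⟩ := Finset.exists_max_image Finset.univ τ ⟨⟨0, hG⟩, Finset.mem_univ _⟩
  replace hl : ∀ i, τ i ≤ τ l := fun i => hl i (Finset.mem_univ i)
  set x : Fin G → ℝ := fun i => Real.logb 2 (max 1 (τ i)) with hx
  have h2x : ∀ i, (2 : ℝ) ^ x i = max 1 (τ i) := fun i =>
    Real.rpow_logb (by norm_num) (by norm_num) (by positivity)
  set I : Fin G → ℝ := fun i => interInterference h p (i, z) (i, z) with hI
  have hI0 : ∀ i, 0 ≤ I i := fun i => interInterference_nonneg _ _ _ _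
  have hrate : ∀ i y, (2 : ℝ) ^ y ≤ D * (I i + 1) →
      ∑ a, decodingRate h p (i, z) (i, a) ≤ C + max 0 (x i - y) := by
    intro i y hy
    refine le_trans ?_ (logb_two_one_add_mul_div_le (A := g * R ^ 2) (by positivity) (hτ0 i)
      (by linarith [hI0 i]) hD1 hy)
    rw [sum_decodingRate_eq h p (i, z) i z]
    have h0 : 0 ≤ ∑ a, rxPower h p (i, z) (i, a) :=
      Finset.sum_nonneg fun a _ => rxPower_nonneg _ _ _ _
    have hIi := hI0 i
    refine logb_two_mono (by positivity) ?_
    gcongr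
    calc ∑ a, rxPower h p (i, z) (i, a) ≤ ∑ _a : Fin g, R ^ 2 * τ i := by
          refine Finset.sum_le_sum fun b _ => (rxPower_le _ _ _ _).trans ?_
          exact mul_le_mul (pow_le_pow_left₀ (norm_nonneg _) (hR i) 2) (ha i b) (sq_nonneg _)
            (sq_nonneg _)
      _ = g * R ^ 2 * τ i := by simp; ring
  have hIle : ∀ i j, i ≠ j → rxPower h p (i, z) (j, a j) ≤ I i := fun i j hij =>
    rxPower_le_interInterference h p (i, z) (i, z) (j, a j) hij.symm
  set b := α * L with hb
  have hb0 : 0 ≤ b := by positivity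
  have h2b : (2 : ℝ) ^ (-b) = P ^ (-α) := by
    rw [hb, hL, show -(α * Real.logb 2 P) = Real.logb 2 P * (-α) by ring,
      Real.rpow_mul (by norm_num), Real.rpow_logb (by norm_num) (by norm_num) hP0]
  have hPα1 : P ^ (-α) ≤ 1 := Real.rpow_le_one_of_one_le_of_nonpos hP (by linarith)
  have hPα0 : 0 < P ^ (-α) := Real.rpow_pos_of_pos hP0 _
  have hpair : ∀ i j, i ≠ j → ∑ a, decodingRate h p (i, z) (i, a)
      ≤ C + max 0 (x i - max 0 (x j - b)) := by
    intro i j hij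
    refine hrate i _ ?_
    rw [(Real.monotone_rpow_of_base_ge_one (by norm_num : (1 : ℝ) ≤ 2)).map_max, Real.rpow_zero,
      sub_eq_add_neg, Real.rpow_add (by norm_num), h2b, h2x]
    have h1 : s * (P ^ (-α) * τ j) ≤ I i := by
      rw [← mul_assoc]; exact (hleak (i, z) (j, a j)).trans (hIle i j hij)
    have h2 : P ^ (-α) * τ j ≤ s⁻¹ * I i := by
      rw [inv_mul_eq_div, le_div_iff₀ hs]; linarith
    have h3 : s⁻¹ ≤ D := le_max_left _ _
    have h4 : s⁻¹ * I i ≤ D * I i := mul_le_mul_of_nonneg_right h3 (hI0 i)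
    have h5 : 0 ≤ D * I i := by have := hI0 i; positivity
    refine max_le (by linarith) ?_
    rw [max_mul_of_nonneg _ _ hPα0.le]
    refine max_le (by linarith) (by linarith)
  have hxmono : ∀ i, x i ≤ x l := fun i =>
    logb_two_mono (by positivity) (max_le_max le_rfl (hl i))
  -- The groups that receive the strongest stream of group `l` badly. All the others, except `l`
  -- itself, suffer interference of the order of `τ l`, hence of their own signal.
  set S := Finset.univ.filter fun i : Fin G =>
      ‖(inner ℂ (h (i, z)) (p (l, a l)) : ℂ)‖ < c * ‖p (l, a l)‖ with hS
  have hout : ∀ i ∉ insert l S, ∑ a, decodingRate h p (i, z) (i, a) ≤ C := by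
    intro i hi
    rw [Finset.mem_insert, not_or] at hi
    have h1 : c ^ 2 * τ l ≤ I i := by
      refine le_trans ?_ (hIle i l hi.1)
      have h2 : c * ‖p (l, a l)‖ ≤ ‖(inner ℂ (h (i, z)) (p (l, a l)) : ℂ)‖ := by
        by_contra h3
        exact hi.2 (Finset.mem_filter.2 ⟨Finset.mem_univ i, not_le.1 h3⟩)
      rw [rxPower, hτ]
      simp only
      rw [← mul_pow]
      exact pow_le_pow_left₀ (by positivity) h2 2
    have h2 := hrate i (x l) (by
      rw [h2x]
      have h2 : τ l ≤ (c ^ 2)⁻¹ * I i := by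
        rw [inv_mul_eq_div, le_div_iff₀ (by positivity)]; linarith
      have h4 : (c ^ 2)⁻¹ * I i ≤ D * I i := mul_le_mul_of_nonneg_right (le_max_right _ _) (hI0 i)
      have h5 : 0 ≤ D * I i := by have := hI0 i; positivity
      exact max_le (by linarith) (by linarith))
    rw [max_eq_left (by linarith [hxmono i])] at h2
    linarith
  have hcard : (insert l S).card ≤ min M G := by
    refine le_min ?_ ?_
    · have := hcond (p (l, a l))
      exact (Finset.card_insert_le _ _).trans this
    · exact (Finset.card_le_univ _).trans_eq (Fintype.card_fin G)
  have hx0 : ∀ i, 0 ≤ x i := fun i => Real.logb_nonneg (by norm_num) (le_max_left _ _)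
  have hmain := sum_le_max_of_leakage (x := x)
    (r := fun i => ∑ a, decodingRate h p (i, z) (i, a) - C) (L := L) (b := b) (l := l)
    (A := insert l S) (N := min M G) hb0 hx0
    (logb_two_mono (by positivity) (max_le hP (hτP l))) hxmono hcard (Finset.mem_insert_self _ _)
    (fun i hi => by have := hout i hi; linarith)
    (by
      have := hrate l 0 (by
        rw [Real.rpow_zero]
        exact one_le_mul_of_one_le_of_one_le hD1 (by linarith [hI0 l]))
      rw [sub_zero, max_eq_right (hx0 l)] at this
      linarith)
    (fun i j hij => by have := hpair i j hij; linarith)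
  rw [Finset.sum_sub_distrib] at hmain
  have hCsum : ∑ _i : Fin G, C = G * C := by simp
  have hfin : max L (((min M G : ℕ) : ℝ) * b) = max 1 (((min M G : ℕ) : ℝ) * α) * L := by
    rw [max_mul_of_nonneg _ _ hL0, one_mul, hb, mul_assoc]
  linarith

end Deterministic

/-! ### The converse for ergodic rates -/

/-- On a compact set of families of vectors, any `M` of which are linearly independent, every
direction is seen well, with a uniform constant, by all but fewer than `M` vectors of the
family. -/
theorem exists_forall_card_inner_lt {M : ℕ} (hM : 1 ≤ M) {ι κ : Type*} [Fintype ι] [LinearOrder ι]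
    (u : ι → κ) {K : Set (κ → EuclideanSpace ℂ (Fin M))} (hK : IsCompact K)
    (hLI : ∀ x ∈ K, ∀ e : Fin M → ι, Function.Injective e →
      LinearIndependent ℂ (fun a => x (u (e a)))) :
    ∃ c : ℝ, 0 < c ∧ ∀ x ∈ K, ∀ v, (Finset.univ.filter fun i : ι =>
      ‖(inner ℂ (x (u i)) v : ℂ)‖ < c * ‖v‖).card < M := by
  have hev : ∀ e : Fin M ↪ ι, ∀ᶠ c : ℝ in 𝓝[>] 0, ∀ x ∈ K, ∀ v,
      ∃ a, c * ‖v‖ ≤ ‖(inner ℂ (x (u (e a))) v : ℂ)‖ := by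
    intro e
    have hcont : Continuous fun y : (κ → EuclideanSpace ℂ (Fin M)) × EuclideanSpace ℂ (Fin M) =>
        ∑ a, ‖(inner ℂ (y.1 (u (e a))) y.2 : ℂ)‖ := by
      refine continuous_finsetSum _ fun a _ => Continuous.norm ?_
      exact ((continuous_apply (u (e a))).comp continuous_fst).inner continuous_snd
    have hpos : ∀ y ∈ K ×ˢ Metric.sphere (0 : EuclideanSpace ℂ (Fin M)) 1,
        0 < ∑ a, ‖(inner ℂ (y.1 (u (e a))) y.2 : ℂ)‖ := by
      rintro ⟨x, v⟩ ⟨hx, hv⟩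
      refine lt_of_le_of_ne (Finset.sum_nonneg fun a _ => norm_nonneg _) fun h0 => ?_
      have h1 := (Finset.sum_eq_zero_iff_of_nonneg fun a _ => norm_nonneg _).1 h0.symm
      have h2 : Submodule.span ℂ (Set.range fun a => x (u (e a))) = ⊤ :=
        (hLI x hx e e.injective).span_eq_top_of_card_eq_finrank' (by simp)
      have h3 : v ∈ (Submodule.span ℂ (Set.range fun a => x (u (e a))))ᗮ := by
        rw [Submodule.mem_orthogonal]
        intro w hw
        induction hw using Submodule.span_induction with
        | mem w hw =>
          obtain ⟨a, rfl⟩ := hw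
          exact norm_eq_zero.1 (h1 a (Finset.mem_univ a))
        | zero => exact inner_zero_left _
        | add w w' _ _ h h' => rw [inner_add_left, h, h', add_zero]
        | smul t w _ h => rw [inner_smul_left, h, mul_zero]
      rw [h2, Submodule.top_orthogonal_eq_bot, Submodule.mem_bot] at h3
      simp [h3] at hv
    obtain ⟨c, hc, hcle⟩ := (hK.prod (isCompact_sphere _ _)).exists_forall_le' hcont.continuousOn
      hpos
    have hM0 : (0 : ℝ) < M := by exact_mod_cast hM
    filter_upwards [Ioo_mem_nhdsGT (show (0 : ℝ) < c / M by positivity)] with t ht x hx v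
    by_cases hv : v = 0
    · exact ⟨⟨0, hM⟩, by simp [hv]⟩
    have hv' : 0 < ‖v‖ := norm_pos_iff.2 hv
    by_contra! hcon
    have h1 := hcle (x, ((‖v‖⁻¹ : ℝ) : ℂ) • v) ⟨hx, by
      simp [norm_smul, hv'.ne']⟩
    have h2 : ∀ a ∈ Finset.univ, ‖(inner ℂ (x (u (e a))) (((‖v‖⁻¹ : ℝ) : ℂ) • v) : ℂ)‖ ≤ t := by
      intro a _
      rw [inner_smul_right, norm_mul, Complex.norm_real, norm_inv, norm_norm, inv_mul_eq_div,
        div_le_iff₀ hv']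
      exact (hcon a).le
    have h3 := Finset.sum_le_card_nsmul _ _ _ h2
    simp only [Finset.card_univ, Fintype.card_fin, nsmul_eq_mul] at h3
    have h4 : M * t < c := by
      have := ht.2
      rw [lt_div_iff₀ hM0] at this
      linarith
    linarith
  obtain ⟨c, hc, hc0⟩ := ((eventually_all.2 hev).and self_mem_nhdsWithin).exists
  refine ⟨c, hc0, fun x hx v => ?_⟩
  by_contra! hcard
  obtain ⟨T, hTS, hT⟩ := Finset.exists_subset_card_eq hcard
  obtain ⟨a, ha⟩ := hc (T.orderEmbOfFin hT).toEmbedding x hx v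
  have := hTS (T.orderEmbOfFin_mem hT a)
  rw [Finset.mem_filter] at this
  exact absurd this.2 (not_lt.2 ha)

section Converse

variable {Ω : Type*} [MeasurableSpace Ω] {M G g : ℕ} {μ : Measure Ω} {α : ℝ}
  {H : Ω → UserVectors M G g} {Hhat : ℝ → Ω → UserVectors M G g}

theorem measurable_rxPower {f h : Ω → UserVectors M G g} (hf : Measurable f)
    (hh : Measurable h) (j m : User G g) : Measurable fun ω => rxPower (f ω) (h ω) j m :=
  (measurable_inner_user hf hh j m).norm.pow_const 2

theorem measurable_decodingRate {f h : Ω → UserVectors M G g} (hf : Measurable f)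
    (hh : Measurable h) (j k : User G g) : Measurable fun ω => decodingRate (f ω) (h ω) j k := by
  have h1 := measurable_rxPower hf hh
  have h2 : Measurable fun ω => intraInterference (f ω) (h ω) j k :=
    Finset.measurable_fun_sum _ fun m _ => h1 _ _
  have h3 : Measurable fun ω => interInterference (f ω) (h ω) j k :=
    Finset.measurable_fun_sum _ fun l _ => Finset.measurable_fun_sum _ fun m _ => h1 _ _
  exact (Real.measurable_log.comp
    (measurable_const.add ((h1 j k).div ((h2.add h3).add_const 1)))).div_const _

theorem IsCSITModel.integrable_norm_sq (hmodel : IsCSITModel μ α H Hhat) (k : User G g) :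
    Integrable (fun ω => ‖H ω k‖ ^ 2) μ :=
  (hmodel.memLp_channel k).integrable_norm_pow (by norm_num)

theorem IsCSITModel.integrable_logb (hmodel : IsCSITModel μ α H Hhat) (k : User G g) :
    Integrable (fun ω => Real.logb 2 (1 + ‖H ω k‖ ^ 2)) μ := by
  refine Integrable.mono' ((hmodel.integrable_norm_sq k).div_const (Real.log 2)) ?_ ?_
  · exact ((Real.measurable_log.comp (measurable_const.add
      (((measurable_pi_apply k).comp hmodel.measurable_channel).norm.pow_const 2))).div_const
        _).aestronglyMeasurable
  · refine Eventually.of_forall fun ω => ?_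
    rw [Real.norm_of_nonneg (logb_two_one_add_nonneg (sq_nonneg _))]
    exact logb_two_one_add_le (sq_nonneg _)

theorem norm_sq_le_of_sum_le {P : ℝ} {p : UserVectors M G g} (hp : ∑ k, ‖p k‖ ^ 2 ≤ P)
    (k : User G g) : ‖p k‖ ^ 2 ≤ P :=
  (Finset.single_le_sum (f := fun k => ‖p k‖ ^ 2) (fun _ _ => sq_nonneg _)
    (Finset.mem_univ k)).trans hp

theorem IsCSITModel.integrable_decodingRate (hmodel : IsCSITModel μ α H Hhat) {P : ℝ} (hP : 1 ≤ P)
    {p : UserVectors M G g → UserVectors M G g} (hp : IsPrecodingPolicy P p) (j k : User G g) :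
    Integrable (fun ω => decodingRate (H ω) (p (Hhat P ω)) j k) μ := by
  refine Integrable.mono' (((hmodel.integrable_norm_sq j).mul_const P).div_const (Real.log 2)) ?_ ?_
  · exact (measurable_decodingRate hmodel.measurable_channel
      (hp.measurable.comp (hmodel.measurable_estimate P hP)) j k).aestronglyMeasurable
  · refine Eventually.of_forall fun ω => ?_
    rw [Real.norm_of_nonneg (decodingRate_nonneg _ _ _ _)]
    refine (decodingRate_le_logb_rxPower _ _ _ _).trans
      ((logb_two_one_add_le (rxPower_nonneg _ _ _ _)).trans ?_)
    have : 0 < Real.log 2 := Real.log_pos (by norm_num)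
    gcongr
    exact (rxPower_le _ _ _ _).trans (by gcongr; exact norm_sq_le_of_sum_le (hp.power_le _) k)

/-- The first user of each group has to decode all the messages of the group. -/
theorem IsCSITModel.sum_userRate_le_integral (hmodel : IsCSITModel μ α H Hhat) {P : ℝ} (hP : 1 ≤ P)
    {p : UserVectors M G g → UserVectors M G g} (hp : IsPrecodingPolicy P p)
    {z : Fin g} (hz : ∀ a, z ≤ a) :
    ∑ k, userRate μ H (Hhat P) p k
      ≤ ∫ ω, ∑ i, ∑ a, decodingRate (H ω) (p (Hhat P ω)) (i, z) (i, a) ∂μ := by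
  rw [integral_finsetSum _ fun i _ => integrable_finsetSum _ fun a _ =>
    hmodel.integrable_decodingRate hP hp _ _, Fintype.sum_prod_type]
  refine Finset.sum_le_sum fun i _ => ?_
  rw [integral_finsetSum _ fun a _ => hmodel.integrable_decodingRate hP hp _ _]
  refine Finset.sum_le_sum fun a _ => ?_
  exact Finset.inf'_le _ (Finset.mem_Iic.2 (hz a))

theorem IsCSITModel.bddAbove_achievableSumRates [IsProbabilityMeasure μ]
    (hmodel : IsCSITModel μ α H Hhat) (hg : 1 ≤ g) {P : ℝ} (hP : 1 ≤ P) :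
    BddAbove (achievableSumRates μ H (Hhat P) P) := by
  refine ⟨∫ ω, ∑ i, (Real.logb 2 P + Real.logb 2 (1 + ‖H ω (i, ⟨0, hg⟩)‖ ^ 2)) ∂μ, ?_⟩
  rintro r ⟨p, hp, rfl⟩
  refine (hmodel.sum_userRate_le_integral hP hp (z := ⟨0, hg⟩) fun a => Nat.zero_le _).trans ?_
  refine integral_mono (integrable_finsetSum _ fun i _ => integrable_finsetSum _ fun a _ =>
    hmodel.integrable_decodingRate hP hp _ _) (integrable_finsetSum _ fun i _ =>
      (integrable_const _).add (hmodel.integrable_logb _)) fun ω => ?_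
  exact Finset.sum_le_sum fun i _ => sum_decodingRate_le_logb hP _ _ (hp.power_le _) _ _ ⟨0, hg⟩

theorem tendsto_logb_two_atTop : Tendsto (fun P : ℝ => Real.logb 2 P) atTop atTop :=
  Real.tendsto_logb_atTop (by norm_num)

/-- The converse: no policy exceeds the pre-log factor `max 1 (min M G * α)`, uniformly over the
policies. -/
theorem IsCSITModel.eventually_sum_userRate_le [IsProbabilityMeasure μ]
    (hmodel : IsCSITModel μ α H Hhat) (hM : 1 ≤ M) (hG : 1 ≤ G) (hg : 1 ≤ g) (hα0 : 0 ≤ α)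
    {ε : ℝ} (hε : 0 < ε) :
    ∀ᶠ P in atTop, ∀ p, IsPrecodingPolicy P p →
      ∑ k, userRate μ H (Hhat P) p k
        ≤ (max 1 (((min M G : ℕ) : ℝ) * α) + ε) * Real.logb 2 P := by
  classical
  set d := max 1 (((min M G : ℕ) : ℝ) * α) with hd
  set z : Fin g := ⟨0, hg⟩ with hz
  set n : ℝ := (Fintype.card (User G g × User G g) : ℝ) with hn
  have hn0 : 0 ≤ n := Nat.cast_nonneg _
  -- The exceptional event has probability at most `(1 + n) * δ`, and there each of the `G` groups
  -- has a rate of at most about `log₂ P`: the loss is at most `(ε / 2) * log₂ P`.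
  set δ : ℝ := ε / (2 * (G + 1) * (1 + n)) with hδ
  have hδ0 : 0 < δ := by positivity
  set U : Set (UserVectors M G g) := ⋂ e : {e : Fin M → Fin G // Function.Injective e},
    {x | LinearIndependent ℂ (fun a => x (e.1 a, z))} with hU
  have hUo : IsOpen U := isOpen_iInter_of_finite fun e =>
    isOpen_setOf_linearIndependent_comp (fun a => (e.1 a, z))
  have hUae : ∀ᵐ x, x ∈ U := by
    simp only [hU, Set.mem_iInter]
    refine ae_all_iff.2 fun e => ae_linearIndependent_comp le_rfl (fun a => (e.1 a, z)) ?_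
    intro a b hab
    exact e.2 (Prod.ext_iff.1 hab).1
  obtain ⟨K, hKU, hK, hKδ⟩ := exists_isCompact_measureReal_notMem_le hmodel.measurable_channel
    hmodel.absolutelyContinuous hUo hUae hδ0
  obtain ⟨c, hc, hcond⟩ := exists_forall_card_inner_lt hM (fun i : Fin G => (i, z)) hK
    (fun x hx e he => Set.mem_iInter.1 (hKU hx) ⟨e, he⟩)
  obtain ⟨R, hR⟩ := hK.isBounded.exists_norm_le
  obtain ⟨s, hs, hs1, hsP⟩ := hmodel.exists_measureReal_rxPower_lt_le hδ0
  set C : ℝ := |G * (Real.logb 2 (1 + g * R ^ 2) + 1 + Real.logb 2 (max s⁻¹ (c ^ 2)⁻¹))| with hC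
  set E : ℝ := ∫ ω, ∑ i, Real.logb 2 (1 + ‖H ω (i, z)‖ ^ 2) ∂μ with hE
  filter_upwards [hsP, eventually_ge_atTop (1 : ℝ),
    tendsto_logb_two_atTop.eventually_ge_atTop ((C + E) / (ε / 2))] with P hPs hP hPL p hp
  set L := Real.logb 2 P with hL
  have hL0 : 0 ≤ L := Real.logb_nonneg (by norm_num) hP
  have hpm : Measurable fun ω => p (Hhat P ω) :=
    hp.measurable.comp (hmodel.measurable_estimate P hP)
  set F : User G g × User G g → Set Ω := fun jm =>
    {ω | rxPower (H ω) (p (Hhat P ω)) jm.1 jm.2 < s * P ^ (-α) * ‖p (Hhat P ω) jm.2‖ ^ 2} with hF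
  set bad : Set Ω := {ω | H ω ∉ K} ∪ ⋃ jm, F jm with hbad
  have hbadm : MeasurableSet bad := by
    refine MeasurableSet.union (hmodel.measurable_channel hK.measurableSet).compl
      (MeasurableSet.iUnion fun jm => ?_)
    exact measurableSet_lt (measurable_rxPower hmodel.measurable_channel hpm _ _)
      ((((measurable_pi_apply jm.2).comp hpm).norm.pow_const 2).const_mul _)
  have hbadμ : μ.real bad ≤ (1 + n) * δ := by
    have h1 : μ.real (⋃ jm, F jm) ≤ ∑ _jm : User G g × User G g, δ :=
      (measureReal_iUnion_fintype_le _).trans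
        (Finset.sum_le_sum fun jm _ => hPs p hp.measurable jm.1 jm.2)
    rw [Finset.sum_const, nsmul_eq_mul, Finset.card_univ, ← hn] at h1
    linarith [measureReal_union_le (μ := μ) {ω | H ω ∉ K} (⋃ jm, F jm)]
  have hd1 : 1 ≤ d := le_max_left _ _
  have hpt : ∀ ω, ∑ i, ∑ a, decodingRate (H ω) (p (Hhat P ω)) (i, z) (i, a)
      ≤ (d * L + C) + bad.indicator (fun _ => G * L) ω
        + ∑ i, Real.logb 2 (1 + ‖H ω (i, z)‖ ^ 2) := by
    intro ω
    have hS : 0 ≤ ∑ i, Real.logb 2 (1 + ‖H ω (i, z)‖ ^ 2) :=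
      Finset.sum_nonneg fun i _ => logb_two_one_add_nonneg (sq_nonneg _)
    by_cases hω : ω ∈ bad
    · rw [Set.indicator_of_mem hω]
      have h1 : ∑ i, ∑ a, decodingRate (H ω) (p (Hhat P ω)) (i, z) (i, a)
          ≤ ∑ i : Fin G, (L + Real.logb 2 (1 + ‖H ω (i, z)‖ ^ 2)) :=
        Finset.sum_le_sum fun i _ => sum_decodingRate_le_logb hP _ _ (hp.power_le _) _ _ z
      rw [Finset.sum_add_distrib, Finset.sum_const, nsmul_eq_mul, Finset.card_univ,
        Fintype.card_fin] at h1
      have h2 : 0 ≤ d * L := by positivity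
      have h3 : 0 ≤ C := abs_nonneg _
      linarith
    · rw [Set.indicator_of_notMem hω]
      rw [hbad, Set.mem_union, not_or, Set.mem_iUnion, not_exists] at hω
      have hωK : H ω ∈ K := not_not.1 hω.1
      have h1 := sum_decodingRate_le hP hα0 hc hs hs1 hG z (hp.power_le (Hhat P ω))
        (fun i => (norm_le_pi_norm (H ω) (i, z)).trans (hR _ hωK)) (hcond _ hωK)
        (fun j m => not_lt.1 (hω.2 (j, m)))
      have h2 := le_abs_self (G * (Real.logb 2 (1 + g * R ^ 2) + 1
        + Real.logb 2 (max s⁻¹ (c ^ 2)⁻¹)))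
      rw [← hC] at h2
      linarith
  have hEint : Integrable (fun ω => ∑ i, Real.logb 2 (1 + ‖H ω (i, z)‖ ^ 2)) μ :=
    integrable_finsetSum _ fun i _ => hmodel.integrable_logb _
  have hindint : Integrable (bad.indicator fun _ : Ω => (G : ℝ) * L) μ :=
    (integrable_const _).indicator hbadm
  have hint1 : Integrable (fun ω => (d * L + C) + bad.indicator (fun _ => (G : ℝ) * L) ω) μ :=
    (integrable_const _).add hindint
  calc ∑ k, userRate μ H (Hhat P) p k
      ≤ ∫ ω, ∑ i, ∑ a, decodingRate (H ω) (p (Hhat P ω)) (i, z) (i, a) ∂μ :=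
        hmodel.sum_userRate_le_integral hP hp fun a => Nat.zero_le _
    _ ≤ ∫ ω, ((d * L + C) + bad.indicator (fun _ => (G : ℝ) * L) ω
        + ∑ i, Real.logb 2 (1 + ‖H ω (i, z)‖ ^ 2)) ∂μ :=
        integral_mono (integrable_finsetSum _ fun i _ => integrable_finsetSum _ fun a _ =>
          hmodel.integrable_decodingRate hP hp _ _) (hint1.add hEint) hpt
    _ = d * L + C + μ.real bad * (G * L) + E := by
        rw [integral_add hint1 hEint, integral_add (integrable_const _) hindint,
          integral_indicator hbadm, setIntegral_const, integral_const]
        simp [hE]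
    _ ≤ (d + ε) * L := by
        have h1 : μ.real bad * (G * L) ≤ ε / 2 * L := by
          have h2 : (1 + n) * δ * G ≤ ε / 2 := by
            rw [hδ]
            have : (1 + n) * (ε / (2 * (G + 1) * (1 + n))) * G = ε / 2 * (G / (G + 1)) := by
              field_simp
            rw [this]
            have h4 : (G : ℝ) / (G + 1) ≤ 1 := by
              rw [div_le_one (by positivity)]; linarith
            nlinarith
          calc μ.real bad * (G * L) ≤ (1 + n) * δ * (G * L) := by gcongr
            _ = (1 + n) * δ * G * L := by ring
            _ ≤ _ := by gcongr
        have h2 : C + E ≤ ε / 2 * L := by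
          rw [div_le_iff₀ (by positivity)] at hPL
          linarith
        linarith

end Converse

/-! ### Achievability -/

section Achievability

variable {Ω : Type*} [MeasurableSpace Ω] {M G g : ℕ} {μ : Measure Ω} {α : ℝ}
  {H : Ω → UserVectors M G g} {Hhat : ℝ → Ω → UserVectors M G g}

theorem userRate_eq_zero {f : Ω → UserVectors M G g} {p : UserVectors M G g → UserVectors M G g}
    {k : User G g} (hpk : ∀ x, p x k = 0) : userRate μ H f p k = 0 := by
  have h : ∀ j, ergodicDecodingRate μ H f p j k = 0 := by
    intro j
    simp [ergodicDecodingRate, decodingRate, rxPower, hpk]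
  simp only [userRate, h]
  exact Finset.inf'_const _ _

theorem userRate_first_eq {f : Ω → UserVectors M G g} {p : UserVectors M G g → UserVectors M G g}
    {k : User G g} (hk : ∀ a, k.2 ≤ a) :
    userRate μ H f p k = ergodicDecodingRate μ H f p k k := by
  refine le_antisymm (Finset.inf'_le _ (Finset.mem_Iic.2 le_rfl)) (Finset.le_inf' _ _ ?_)
  intro a ha
  rw [le_antisymm (Finset.mem_Iic.1 ha) (hk a)]

/-- The multiplexing gain of the first user of a group, when with high probability the received
power of its stream is of the order of `P ^ θ` and the interference is bounded. -/
theorem IsCSITModel.tendsto_userRate_div_logb [IsProbabilityMeasure μ]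
    (hmodel : IsCSITModel μ α H Hhat) {p : ℝ → UserVectors M G g → UserVectors M G g}
    (hp : ∀ P, 1 ≤ P → IsPrecodingPolicy P (p P)) {k : User G g} (hk : ∀ a, k.2 ≤ a) {θ : ℝ}
    (hθ : 0 ≤ θ) (hup : ∀ P, 1 ≤ P → ∀ x, ‖p P x k‖ ^ 2 ≤ P ^ θ)
    (hlow : ∀ δ : ℝ, 0 < δ → ∃ c V : ℝ, 0 < c ∧ 0 ≤ V ∧ ∀ᶠ P in atTop,
      μ.real {ω | ¬ (c * P ^ θ ≤ rxPower (H ω) (p P (Hhat P ω)) k k ∧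
        interInterference (H ω) (p P (Hhat P ω)) k k ≤ V)} ≤ δ) :
    Tendsto (fun P => userRate μ H (Hhat P) (p P) k / Real.logb 2 P) atTop (𝓝 θ) := by
  set E : ℝ := ∫ ω, Real.logb 2 (1 + ‖H ω k‖ ^ 2) ∂μ with hE
  have hLP : ∀ {P : ℝ}, 0 < P → Real.logb 2 (P ^ θ) = θ * Real.logb 2 P := fun hP =>
    Real.logb_rpow_eq_mul_logb_of_pos hP
  rw [Metric.tendsto_nhds]
  intro ε hε
  set δ : ℝ := min 1 (ε / (4 * (θ + 1))) with hδ
  have hδ0 : 0 < δ := by positivity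
  have hδ1 : δ ≤ 1 := min_le_left _ _
  have hδθ : δ * θ ≤ ε / 4 := by
    calc δ * θ ≤ ε / (4 * (θ + 1)) * (θ + 1) := by
          gcongr
          · exact min_le_right _ _
          · linarith
      _ = ε / 4 := by field_simp
  obtain ⟨c, V, hc, hV, hcV⟩ := hlow δ hδ0
  -- With probability `1 - δ` the rate is at least `log₂ (1 + c' * P ^ θ)`.
  set c' := c / (V + 1) with hc'
  have hc'0 : 0 < c' := by positivity
  filter_upwards [hcV, eventually_ge_atTop (1 : ℝ),
    tendsto_logb_two_atTop.eventually_gt_atTop 0,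
    tendsto_logb_two_atTop.eventually_ge_atTop (|E| / (ε / 2)),
    tendsto_logb_two_atTop.eventually_ge_atTop (|Real.logb 2 c'| / (ε / 4))] with
    P hPcV hP hL0 hLE hLc
  set L := Real.logb 2 P with hL
  have hP0 : 0 < P := by linarith
  have hPθ : 0 < P ^ θ := Real.rpow_pos_of_pos hP0 _
  have hPθ1 : 1 ≤ P ^ θ := Real.one_le_rpow hP hθ
  rw [div_le_iff₀ (by positivity)] at hLE hLc
  have hint := hmodel.integrable_decodingRate hP (hp P hP) k k
  rw [userRate_first_eq hk]
  have hupper : ergodicDecodingRate μ H (Hhat P) (p P) k k ≤ θ * L + E := by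
    calc ergodicDecodingRate μ H (Hhat P) (p P) k k
        ≤ ∫ ω, (θ * L + Real.logb 2 (1 + ‖H ω k‖ ^ 2)) ∂μ := by
          refine integral_mono hint ((integrable_const _).add (hmodel.integrable_logb k))
            fun ω => ?_
          refine (decodingRate_le_logb_rxPower _ _ _ _).trans ?_
          rw [← hLP hP0]
          refine le_trans ?_ (logb_two_one_add_mul_le hPθ1 (sq_nonneg _))
          have h0 := rxPower_nonneg (H ω) (p P (Hhat P ω)) k k
          refine logb_two_mono (by positivity) ?_
          have h1 := (rxPower_le (H ω) (p P (Hhat P ω)) k k).trans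
            (mul_le_mul_of_nonneg_left (hup P hP _) (sq_nonneg _))
          linarith
      _ = θ * L + E := by
          rw [integral_add (integrable_const _) (hmodel.integrable_logb k)]; simp [hE]
  set good : Set Ω := {ω | c * P ^ θ ≤ rxPower (H ω) (p P (Hhat P ω)) k k ∧
        interInterference (H ω) (p P (Hhat P ω)) k k ≤ V} with hgood
  have hpm : Measurable fun ω => p P (Hhat P ω) :=
    (hp P hP).measurable.comp (hmodel.measurable_estimate P hP)
  have hrxm := measurable_rxPower hmodel.measurable_channel hpm
  have hgoodm : MeasurableSet good := by
    have hinterm : Measurable fun ω => interInterference (H ω) (p P (Hhat P ω)) k k :=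
      Finset.measurable_fun_sum _ fun l _ => Finset.measurable_fun_sum _ fun m _ => hrxm _ _
    exact (measurableSet_le measurable_const (hrxm k k)).inter
      (measurableSet_le hinterm measurable_const)
  have hgoodμ : 1 - δ ≤ μ.real good := by
    have h1 : μ.real goodᶜ ≤ δ := hPcV
    rw [probReal_compl_eq_one_sub hgoodm] at h1
    linarith
  have hlower : (1 - δ) * (θ * L + Real.logb 2 c') ≤ ergodicDecodingRate μ H (Hhat P) (p P) k k := by
    have hlog0 : 0 ≤ Real.logb 2 (1 + c' * P ^ θ) := logb_two_one_add_nonneg (by positivity)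
    calc (1 - δ) * (θ * L + Real.logb 2 c') ≤ (1 - δ) * Real.logb 2 (1 + c' * P ^ θ) := by
          refine mul_le_mul_of_nonneg_left ?_ (by linarith)
          rw [← hLP hP0, ← Real.logb_mul (by positivity) (by positivity), mul_comm]
          exact logb_two_mono (by positivity) (by linarith)
      _ ≤ μ.real good * Real.logb 2 (1 + c' * P ^ θ) := by gcongr
      _ = ∫ ω, good.indicator (fun _ => Real.logb 2 (1 + c' * P ^ θ)) ω ∂μ := by
          rw [integral_indicator hgoodm, setIntegral_const, smul_eq_mul]
      _ ≤ ergodicDecodingRate μ H (Hhat P) (p P) k k := by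
          refine integral_mono ((integrable_const _).indicator hgoodm) hint fun ω => ?_
          refine Set.indicator_apply_le' (fun hω => ?_) fun _ => decodingRate_nonneg _ _ _ _
          refine logb_two_mono (by positivity) ?_
          have hintra : intraInterference (H ω) (p P (Hhat P ω)) k k = 0 := by
            rw [intraInterference, Finset.filter_false_of_mem fun m _ => not_lt.2 (hk m)]
            simp
          have h0 := interInterference_nonneg (H ω) (p P (Hhat P ω)) k k
          rw [hintra, zero_add, hc', div_mul_eq_mul_div]
          have h1 := rxPower_nonneg (H ω) (p P (Hhat P ω)) k k
          gcongr
          · exact hω.1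
          · exact hω.2
  rw [Real.dist_eq, abs_sub_lt_iff, sub_lt_iff_lt_add, div_lt_iff₀ hL0, sub_lt_comm,
    lt_div_iff₀ hL0]
  constructor
  · have := le_abs_self E
    nlinarith
  · have h1 := neg_abs_le (Real.logb 2 c')
    have h2 : (1 - δ) * -|Real.logb 2 c'| ≤ (1 - δ) * Real.logb 2 c' :=
      mul_le_mul_of_nonneg_left h1 (by linarith)
    have h3 : (1 - δ) * |Real.logb 2 c'| ≤ |Real.logb 2 c'| := by
      have := abs_nonneg (Real.logb 2 c')
      nlinarith
    have h4 : δ * θ * L ≤ ε / 4 * L := by gcongr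
    nlinarith

/-- A fixed beam towards one user has the full multiplexing gain `1`, without any channel
knowledge. -/
theorem IsCSITModel.exists_policy_single [IsProbabilityMeasure μ]
    (hmodel : IsCSITModel μ α H Hhat) (hM : 1 ≤ M) {k₀ : User G g} (hk₀ : ∀ a, k₀.2 ≤ a) :
    ∃ p : ℝ → UserVectors M G g → UserVectors M G g,
      (∀ P, 1 ≤ P → IsPrecodingPolicy P (p P)) ∧
      ∀ k, Tendsto (fun P => userRate μ H (Hhat P) (p P) k / Real.logb 2 P) atTop
          (𝓝 (if k = k₀ then 1 else 0)) := by
  classical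
  set v : EuclideanSpace ℂ (Fin M) := EuclideanSpace.single ⟨0, hM⟩ 1 with hv
  have hv1 : ‖v‖ = 1 := by simp [hv]
  set p : ℝ → UserVectors M G g → UserVectors M G g := fun P _ k =>
    if k = k₀ then ((Real.sqrt P : ℝ) : ℂ) • v else 0 with hp
  have hpk : ∀ P, 1 ≤ P → ∀ x, ‖p P x k₀‖ ^ 2 = P := by
    intro P hP x
    simp only [hp, if_true, norm_smul, hv1, mul_one, Complex.norm_real, Real.norm_eq_abs, sq_abs]
    exact Real.sq_sqrt (by linarith)
  have hpol : ∀ P, 1 ≤ P → IsPrecodingPolicy P (p P) := by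
    refine fun P hP => ⟨measurable_const, fun x => ?_⟩
    rw [Finset.sum_eq_single k₀ (fun k _ hk => by simp [hp, hk]) (by simp), hpk P hP x]
  refine ⟨p, hpol, fun k => ?_⟩
  by_cases hk : k = k₀
  swap
  · rw [if_neg hk]
    have h0 : ∀ P, userRate μ H (Hhat P) (p P) k = 0 := fun P =>
      userRate_eq_zero fun x => by simp [hp, hk]
    simp [h0]
  subst hk
  rw [if_pos rfl]
  refine hmodel.tendsto_userRate_div_logb hpol hk₀ zero_le_one
    (fun P hP x => by rw [hpk P hP x, Real.rpow_one]) fun δ hδ => ?_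
  set U : Set (UserVectors M G g) := {x | (inner ℂ (x k) v : ℂ) ≠ 0} with hU
  have hcont : Continuous fun x : UserVectors M G g => (inner ℂ (x k) v : ℂ) :=
    (continuous_apply k).inner continuous_const
  have hUo : IsOpen U := isOpen_ne_fun hcont continuous_const
  have hUae : ∀ᵐ x, x ∈ U := by
    suffices h : volume Uᶜ = 0 from
      (measure_eq_zero_iff_ae_notMem.1 h).mono fun x hx => not_not.1 hx
    refine volume_pi_eq_zero_of_slices hUo.measurableSet.compl k fun x => ?_
    have hne : ((ℂ ∙ v)ᗮ).restrictScalars ℝ ≠ ⊤ := by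
      intro h
      have h1 : v ∈ (ℂ ∙ v)ᗮ := by
        have : v ∈ ((ℂ ∙ v)ᗮ).restrictScalars ℝ := h ▸ Submodule.mem_top
        exact this
      rw [Submodule.mem_orthogonal_singleton_iff_inner_right, inner_self_eq_zero] at h1
      simp [h1] at hv1
    refine measure_mono_null ?_ (Measure.addHaar_submodule volume _ hne)
    intro w hw
    have hw' : (inner ℂ w v : ℂ) = 0 := by simpa [hU] using hw
    exact Submodule.mem_orthogonal_singleton_iff_inner_left.2 hw'
  obtain ⟨K, hKU, hK, hKδ⟩ := exists_isCompact_measureReal_notMem_le hmodel.measurable_channel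
    hmodel.absolutelyContinuous hUo hUae hδ
  obtain ⟨c, hc, hcK⟩ := hK.exists_forall_le' hcont.norm.continuousOn
    (fun x hx => norm_pos_iff.2 (hKU hx))
  refine ⟨c ^ 2, 0, by positivity, le_rfl, ?_⟩
  filter_upwards [eventually_ge_atTop (1 : ℝ)] with P hP
  refine (measureReal_mono fun ω hω => ?_).trans hKδ
  intro hωK
  refine hω ⟨?_, ?_⟩
  · have h1 : rxPower (H ω) (p P (Hhat P ω)) k k = P * ‖(inner ℂ (H ω k) v : ℂ)‖ ^ 2 := by
      simp only [rxPower, hp, if_true, inner_smul_right, norm_mul, mul_pow, Complex.norm_real,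
        Real.norm_eq_abs, sq_abs]
      rw [Real.sq_sqrt (by linarith)]
    rw [h1, Real.rpow_one, mul_comm]
    have := pow_le_pow_left₀ hc.le (hcK _ hωK) 2
    gcongr
  · refine le_of_eq (Finset.sum_eq_zero fun l hl => Finset.sum_eq_zero fun m _ => ?_)
    have hne : (l, m) ≠ k := fun h => (Finset.mem_filter.1 hl).2 (by rw [← h])
    simp [rxPower, hp, hne]

/-- The zero-forcing vector for user `b` of the set `T`, for the channels `y`: it is orthogonal to
the channels of all the other users of `T`. It is written with the adjugate of the Gram matrix,
which makes it a polynomial, hence continuous, function of `y` and its conjugate; it vanishes where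
the channels of `T` are linearly dependent. -/
noncomputable def zeroForcingVector (T : Finset (User G g)) (y : UserVectors M G g) (b : T) :
    EuclideanSpace ℂ (Fin M) :=
  ∑ a, (Matrix.gram ℂ fun a : T => y a).adjugate a b • y a

theorem inner_zeroForcingVector (T : Finset (User G g)) (y : UserVectors M G g) (a b : T) :
    inner ℂ (y a) (zeroForcingVector T y b)
      = if a = b then (Matrix.gram ℂ fun a : T => y a).det else 0 := by
  have h := congrFun (congrFun (Matrix.mul_adjugate (Matrix.gram ℂ fun a : T => y a)) a) b
  rw [Matrix.mul_apply] at h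
  simp only [Matrix.smul_apply, Matrix.one_apply, smul_eq_mul, mul_ite, mul_one, mul_zero,
    Matrix.gram_apply] at h
  rw [← h, zeroForcingVector, inner_sum]
  refine Finset.sum_congr rfl fun c _ => ?_
  rw [inner_smul_right, mul_comm]

theorem continuous_gram (T : Finset (User G g)) :
    Continuous fun y : UserVectors M G g => Matrix.gram ℂ fun a : T => y a :=
  continuous_matrix fun a b => by
    simp only [Matrix.gram_apply]
    exact (continuous_apply (a : User G g)).inner (continuous_apply (b : User G g))

theorem continuous_zeroForcingVector (T : Finset (User G g)) (b : T) :
    Continuous fun y : UserVectors M G g => zeroForcingVector T y b :=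
  continuous_finsetSum _ fun a _ =>
    ((continuous_gram T).matrix_adjugate.matrix_elem a b).smul (continuous_apply _)

/-- Zero-forcing precoding with power `q` (or `0`, where the zero-forcing vector vanishes) for each
of the users in `T`, based on the channel estimates `y`; nothing is sent to the other users. -/
noncomputable def zeroForcingPolicy (T : Finset (User G g)) (q : ℝ) (y : UserVectors M G g) :
    UserVectors M G g := fun k =>
  if h : k ∈ T then
    ((Real.sqrt q * ‖zeroForcingVector T y ⟨k, h⟩‖⁻¹ : ℝ) : ℂ) • zeroForcingVector T y ⟨k, h⟩
  else 0

theorem zeroForcingPolicy_of_notMem {T : Finset (User G g)} {q : ℝ} {y : UserVectors M G g}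
    {k : User G g} (hk : k ∉ T) : zeroForcingPolicy T q y k = 0 :=
  dif_neg hk

theorem norm_sq_zeroForcingPolicy_le (T : Finset (User G g)) {q : ℝ} (hq : 0 ≤ q)
    (y : UserVectors M G g) (k : User G g) : ‖zeroForcingPolicy T q y k‖ ^ 2 ≤ q := by
  by_cases hk : k ∈ T
  · rw [zeroForcingPolicy, dif_pos hk, norm_smul, Complex.norm_real, Real.norm_eq_abs, abs_mul,
      abs_inv, abs_norm, abs_of_nonneg (Real.sqrt_nonneg q), mul_assoc, mul_pow, Real.sq_sqrt hq]
    refine mul_le_of_le_one_right hq (pow_le_one₀ (by positivity) ?_)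
    exact inv_mul_le_one
  · rw [zeroForcingPolicy_of_notMem hk]; simpa using hq

theorem isPrecodingPolicy_zeroForcingPolicy (T : Finset (User G g)) {q P : ℝ} (hq : 0 ≤ q)
    (hP : T.card * q ≤ P) :
    IsPrecodingPolicy P (zeroForcingPolicy (M := M) T q) := by
  refine ⟨measurable_pi_lambda _ fun k => ?_, fun y => ?_⟩
  · by_cases hk : k ∈ T
    · simp only [zeroForcingPolicy, dif_pos hk]
      have := (continuous_zeroForcingVector (M := M) T ⟨k, hk⟩).measurable
      exact (Complex.measurable_ofReal.comp (this.norm.inv.const_mul _)).smul this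
    · simp only [zeroForcingPolicy, dif_neg hk]
      exact measurable_const
  · refine le_trans ?_ hP
    rw [← Finset.sum_subset (Finset.subset_univ T) fun k _ hk => by
      rw [zeroForcingPolicy_of_notMem hk]; simp, ← nsmul_eq_mul]
    exact Finset.sum_le_card_nsmul _ _ _ fun k _ => norm_sq_zeroForcingPolicy_le T hq y k

theorem inner_zeroForcingPolicy_of_ne {T : Finset (User G g)} {q : ℝ} {y : UserVectors M G g}
    {j k : User G g} (hj : j ∈ T) (hjk : j ≠ k) :
    (inner ℂ (y j) (zeroForcingPolicy T q y k) : ℂ) = 0 := by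
  by_cases hk : k ∈ T
  · rw [zeroForcingPolicy, dif_pos hk, inner_smul_right]
    have := inner_zeroForcingVector T y ⟨j, hj⟩ ⟨k, hk⟩
    rw [if_neg (by simpa using hjk)] at this
    rw [this, mul_zero]
  · rw [zeroForcingPolicy_of_notMem hk, inner_zero_right]

/-- Zero-forcing leaks no more power to the other users than the estimation error lets through. -/
theorem rxPower_zeroForcingPolicy_le {T : Finset (User G g)} {q : ℝ} (hq : 0 ≤ q)
    (h y : UserVectors M G g) {j k : User G g} (hj : j ∈ T) (hjk : j ≠ k) :
    rxPower h (zeroForcingPolicy T q y) j k ≤ ‖h j - y j‖ ^ 2 * q := by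
  have h1 : (inner ℂ (h j) (zeroForcingPolicy T q y k) : ℂ)
      = inner ℂ (h j - y j) (zeroForcingPolicy T q y k) := by
    rw [inner_sub_left, inner_zeroForcingPolicy_of_ne hj hjk, sub_zero]
  rw [rxPower, h1]
  refine (pow_le_pow_left₀ (norm_nonneg _) (norm_inner_le_norm _ _) 2).trans ?_
  rw [mul_pow]
  gcongr
  exact norm_sq_zeroForcingPolicy_le T hq y k

/-- On a compact set of linearly independent channels, the zero-forcing beam of each user has a
uniformly positive gain for its own channel. -/
theorem exists_le_norm_inner_zeroForcingPolicy {T : Finset (User G g)} {K : Set (UserVectors M G g)}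
    (hK : IsCompact K) (hLI : ∀ y ∈ K, LinearIndependent ℂ fun a : T => y a) {k : User G g}
    (hk : k ∈ T) :
    ∃ c : ℝ, 0 < c ∧ ∀ y ∈ K, ∀ q : ℝ,
      c * Real.sqrt q ≤ ‖(inner ℂ (y k) (zeroForcingPolicy T q y k) : ℂ)‖ := by
  have hdet : ∀ y ∈ K, (Matrix.gram ℂ fun a : T => y a).det ≠ 0 := fun y hy =>
    (Matrix.posSemidef_gram ℂ _).posDef_iff_det_ne_zero.1
      (Matrix.posDef_gram_of_linearIndependent (hLI y hy))
  have hin : ∀ y : UserVectors M G g, (inner ℂ (y k) (zeroForcingVector T y ⟨k, hk⟩) : ℂ)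
      = (Matrix.gram ℂ fun a : T => y a).det := by
    intro y
    have := inner_zeroForcingVector T y ⟨k, hk⟩ ⟨k, hk⟩
    rwa [if_pos rfl] at this
  have hz : ∀ y ∈ K, ‖zeroForcingVector T y ⟨k, hk⟩‖ ≠ 0 := by
    intro y hy h0
    refine hdet y hy ?_
    rw [← hin, norm_eq_zero.1 h0, inner_zero_right]
  have hcont : ContinuousOn (fun y : UserVectors M G g =>
      ‖zeroForcingVector T y ⟨k, hk⟩‖⁻¹ * ‖(Matrix.gram ℂ fun a : T => y a).det‖) K :=
    ((continuous_zeroForcingVector T ⟨k, hk⟩).norm.continuousOn.inv₀ hz).mul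
      (continuous_gram T).matrix_det.norm.continuousOn
  obtain ⟨c, hc, hcK⟩ := hK.exists_forall_le' hcont (a := 0) fun y hy => by
    have h1 := norm_pos_iff.2 (hdet y hy)
    have h2 := lt_of_le_of_ne (norm_nonneg _) (hz y hy).symm
    positivity
  refine ⟨c, hc, fun y hy q => ?_⟩
  rw [zeroForcingPolicy, dif_pos hk, inner_smul_right, hin, norm_mul, Complex.norm_real,
    Real.norm_eq_abs, abs_mul, abs_inv, abs_norm, abs_of_nonneg (Real.sqrt_nonneg q), mul_assoc,
    mul_comm c]
  exact mul_le_mul_of_nonneg_left (hcK y hy) (Real.sqrt_nonneg q)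

theorem ae_linearIndependent_finset (T : Finset (User G g)) (hT : T.card ≤ M) :
    ∀ᵐ x : UserVectors M G g, LinearIndependent ℂ fun a : T => x a := by
  have h := ae_linearIndependent_comp (M := M) hT (fun a => ((T.equivFin.symm a : T) : User G g))
    (Subtype.val_injective.comp T.equivFin.symm.injective)
  filter_upwards [h] with x hx
  exact (linearIndependent_equiv T.equivFin.symm (f := fun a : T => x a)).1 hx

/-- Zero-forcing with the power `P ^ α` gives the multiplexing gain `α` to the first users of up to
`M` groups: the leakage through the estimation error stays at the noise level. -/
theorem IsCSITModel.exists_policy_zeroForcing [IsProbabilityMeasure μ]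
    (hmodel : IsCSITModel μ α H Hhat) (hα0 : 0 < α) (hα1 : α ≤ 1) {T : Finset (User G g)}
    (hTM : T.card ≤ M) (hT : ∀ k ∈ T, ∀ a, k.2 ≤ a) :
    ∃ p : ℝ → UserVectors M G g → UserVectors M G g,
      (∀ P, 1 ≤ P → IsPrecodingPolicy P (p P)) ∧
      ∀ k, Tendsto (fun P => userRate μ H (Hhat P) (p P) k / Real.logb 2 P) atTop
          (𝓝 (if k ∈ T then α else 0)) := by
  classical
  set p : ℝ → UserVectors M G g → UserVectors M G g := fun P =>
    zeroForcingPolicy T (P ^ α / (T.card + 1)) with hp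
  -- The power `P ^ α` is as large as the leakage permits; as `α ≤ 1`, it meets the power constraint.
  have hq0 : ∀ P : ℝ, 1 ≤ P → 0 ≤ P ^ α / (T.card + 1) := fun P hP => by
    have := Real.rpow_nonneg (by linarith : 0 ≤ P) α; positivity
  have hq1 : ∀ P : ℝ, 1 ≤ P → P ^ α / (T.card + 1) ≤ P ^ α := fun P hP =>
    div_le_self (Real.rpow_nonneg (by linarith) α) (by simp)
  have hpol : ∀ P, 1 ≤ P → IsPrecodingPolicy P (p P) := fun P hP => by
    refine isPrecodingPolicy_zeroForcingPolicy T (hq0 P hP) ?_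
    have h1 : P ^ α ≤ P := by
      simpa using Real.rpow_le_rpow_of_exponent_le hP hα1
    refine le_trans ?_ h1
    rw [mul_div_assoc', div_le_iff₀ (by positivity)]
    have : 0 ≤ P ^ α := Real.rpow_nonneg (by linarith) α
    linarith
  refine ⟨p, hpol, fun k => ?_⟩
  by_cases hk : k ∈ T
  swap
  · rw [if_neg hk]
    have h0 : ∀ P, userRate μ H (Hhat P) (p P) k = 0 := fun P =>
      userRate_eq_zero fun x => zeroForcingPolicy_of_notMem hk
    simp [h0]
  rw [if_pos hk]
  refine hmodel.tendsto_userRate_div_logb hpol (hT k hk) hα0.le (fun P hP x =>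
    (norm_sq_zeroForcingPolicy_le T (hq0 P hP) x k).trans (hq1 P hP)) fun δ hδ => ?_
  set U : Set (UserVectors M G g) := {x | LinearIndependent ℂ fun a : T => x a} with hU
  have hUo : IsOpen U := isOpen_setOf_linearIndependent_comp (fun a : T => (a : User G g))
  obtain ⟨K, hKU, hK, hKδ⟩ := exists_isCompact_measureReal_notMem_le hmodel.measurable_channel
    hmodel.absolutelyContinuous hUo (ae_linearIndependent_finset T hTM) (half_pos hδ)
  obtain ⟨ρ, hρ, hρU⟩ := hK.exists_cthickening_subset_open hUo hKU
  obtain ⟨c, hc, hcK⟩ := exists_le_norm_inner_zeroForcingPolicy hK.cthickening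
    (fun y hy => hρU hy) hk
  set Γ : ℝ := ∑ k, ∫ ω, ‖H ω k‖ ^ 2 ∂μ with hΓ
  have hΓ0 : 0 ≤ Γ := Finset.sum_nonneg fun k _ => integral_nonneg fun ω => by positivity
  -- By Markov's inequality, `V * P ^ (-α)` bounds all the squared errors outside an event of
  -- probability at most `δ / 2`. It tends to `0` since `0 < α`, so that the estimates are then in
  -- the compact neighbourhood `cthickening ρ K` of the channels.
  set V : ℝ := 2 * (Γ + 1) / δ with hV
  have hV0 : 0 < V := by positivity
  refine ⟨c ^ 2 / 4 / (T.card + 1), G * (g * V), by positivity, by positivity, ?_⟩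
  have hlim : Tendsto (fun P : ℝ => V * P ^ (-α)) atTop (𝓝 0) := by
    simpa using (tendsto_rpow_neg_atTop hα0).const_mul V
  filter_upwards [eventually_ge_atTop (1 : ℝ),
    hlim.eventually_le_const (show 0 < min (ρ ^ 2) ((c / 2) ^ 2) by positivity)] with P hP hPV
  have hP0 : 0 < P := by linarith
  have hPα : 0 < P ^ α := Real.rpow_pos_of_pos hP0 _
  have hPnα : 0 < P ^ (-α) := Real.rpow_pos_of_pos hP0 _
  have hPP : P ^ (-α) * P ^ α = 1 := by rw [← Real.rpow_add hP0]; simp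
  set F : User G g → Set Ω := fun j => {ω | V * P ^ (-α) ≤ ‖H ω j - Hhat P ω j‖ ^ 2} with hF
  have hFμ : ∀ j, μ.real (F j) ≤ (∫ ω, ‖H ω j‖ ^ 2 ∂μ) / V := by
    intro j
    have h1 := hmodel.mul_measureReal_error_le hP j (V * P ^ (-α))
    rw [le_div_iff₀ hV0]
    refine le_of_mul_le_mul_left ?_ hPnα
    linarith
  have hFsum : μ.real (⋃ j, F j) ≤ δ / 2 := by
    refine (measureReal_iUnion_fintype_le _).trans ((Finset.sum_le_sum fun j _ => hFμ j).trans ?_)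
    rw [← Finset.sum_div, ← hΓ, hV, div_div_eq_mul_div, div_le_iff₀ (by positivity)]
    nlinarith
  have hsub : {ω | ¬ (c ^ 2 / 4 / (T.card + 1) * P ^ α ≤ rxPower (H ω) (p P (Hhat P ω)) k k ∧
        interInterference (H ω) (p P (Hhat P ω)) k k ≤ G * (g * V))}
      ⊆ {ω | H ω ∉ K} ∪ ⋃ j, F j := by
    intro ω hω
    by_contra hgood
    rw [Set.mem_union, not_or, Set.mem_iUnion, not_exists] at hgood
    have hωK : H ω ∈ K := not_not.1 hgood.1
    have herr : ∀ j, ‖H ω j - Hhat P ω j‖ ^ 2 < V * P ^ (-α) := fun j => not_le.1 (hgood.2 j)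
    have herrρ : ∀ j, ‖H ω j - Hhat P ω j‖ ≤ ρ := fun j =>
      le_of_sq_le_sq ((herr j).le.trans (hPV.trans (min_le_left _ _))) hρ.le
    have herrc : ‖H ω k - Hhat P ω k‖ ≤ c / 2 :=
      le_of_sq_le_sq ((herr k).le.trans (hPV.trans (min_le_right _ _))) (by positivity)
    have hhat : Hhat P ω ∈ Metric.cthickening ρ K := by
      refine Metric.mem_cthickening_of_dist_le _ (H ω) _ _ hωK ?_
      rw [dist_comm, dist_pi_le_iff hρ.le]
      intro j
      rw [dist_eq_norm]
      exact herrρ j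
    set q := P ^ α / (T.card + 1) with hq
    have hq' : 0 ≤ q := hq0 P hP
    refine hω ⟨?_, ?_⟩
    · have h1 := hcK _ hhat q
      have h2 : ‖p P (Hhat P ω) k‖ ≤ Real.sqrt q := by
        refine Real.le_sqrt_of_sq_le ?_
        exact norm_sq_zeroForcingPolicy_le T hq' _ _
      have h3 : (inner ℂ (Hhat P ω k) (p P (Hhat P ω) k) : ℂ)
          = inner ℂ (H ω k) (p P (Hhat P ω) k)
            - inner ℂ (H ω k - Hhat P ω k) (p P (Hhat P ω) k) := by
        rw [inner_sub_left]; ring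
      have h4 : ‖(inner ℂ (H ω k - Hhat P ω k) (p P (Hhat P ω) k) : ℂ)‖ ≤ c / 2 * Real.sqrt q :=
        (norm_inner_le_norm _ _).trans (by gcongr)
      have h5 : c / 2 * Real.sqrt q ≤ ‖(inner ℂ (H ω k) (p P (Hhat P ω) k) : ℂ)‖ := by
        have h6 := norm_sub_le (inner ℂ (H ω k) (p P (Hhat P ω) k) : ℂ)
          (inner ℂ (H ω k - Hhat P ω k) (p P (Hhat P ω) k))
        rw [← h3] at h6
        have h7 : c * Real.sqrt q ≤ ‖(inner ℂ (Hhat P ω k) (p P (Hhat P ω) k) : ℂ)‖ := h1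
        linarith
      have h6 := pow_le_pow_left₀ (by positivity) h5 2
      rw [mul_pow, Real.sq_sqrt hq'] at h6
      calc _ = (c / 2) ^ 2 * q := by rw [hq]; ring
        _ ≤ _ := h6
    · have h1 : ∀ l ∈ Finset.univ.filter (fun l : Fin G => l ≠ k.1), ∀ m : Fin g,
          rxPower (H ω) (p P (Hhat P ω)) k (l, m) ≤ V := by
        intro l hl m
        have hne : k ≠ (l, m) := fun h => (Finset.mem_filter.1 hl).2 (by rw [h])
        refine (rxPower_zeroForcingPolicy_le hq' _ _ hk hne).trans ?_
        calc _ ≤ V * P ^ (-α) * P ^ α := mul_le_mul (herr k).le (hq1 P hP) hq' (by positivity)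
          _ = V := by rw [mul_assoc, hPP, mul_one]
      calc interInterference (H ω) (p P (Hhat P ω)) k k
          ≤ ∑ l ∈ Finset.univ.filter (fun l : Fin G => l ≠ k.1), ∑ _m : Fin g, V :=
            Finset.sum_le_sum fun l hl => Finset.sum_le_sum fun m _ => h1 l hl m
        _ ≤ ∑ _l : Fin G, ∑ _m : Fin g, V :=
            Finset.sum_le_sum_of_subset_of_nonneg (Finset.filter_subset _ _) fun _ _ _ => by
              positivity
        _ = G * (g * V) := by simp
  calc _ ≤ _ := measureReal_mono hsub
    _ ≤ _ := measureReal_union_le _ _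
    _ ≤ δ := by linarith

/-- The multiplexing gain is attained, by a single beam or by zero-forcing. -/
theorem IsCSITModel.exists_policy_tendsto [IsProbabilityMeasure μ]
    (hmodel : IsCSITModel μ α H Hhat) (hM : 1 ≤ M) (hG : 1 ≤ G) (hg : 1 ≤ g) (hα0 : 0 ≤ α)
    (hα1 : α ≤ 1) :
    ∃ p : ℝ → UserVectors M G g → UserVectors M G g,
      (∀ P : ℝ, 1 ≤ P → IsPrecodingPolicy P (p P)) ∧
      ∃ d : User G g → ℝ,
        (∀ k, Tendsto (fun P : ℝ => userRate μ H (Hhat P) (p P) k / Real.logb 2 P) atTop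
          (𝓝 (d k))) ∧
        ∑ k, d k = max 1 (((min M G : ℕ) : ℝ) * α) := by
  classical
  set z : Fin g := ⟨0, hg⟩ with hz
  have hz0 : ∀ a, z ≤ a := fun a => Nat.zero_le _
  by_cases hcase : ((min M G : ℕ) : ℝ) * α ≤ 1
  · obtain ⟨p, hp, hlim⟩ := hmodel.exists_policy_single hM (k₀ := (⟨0, hG⟩, z)) hz0
    refine ⟨p, hp, _, hlim, ?_⟩
    rw [max_eq_left hcase]
    simp
  · have hα : 0 < α := by
      refine lt_of_le_of_ne hα0 fun h => hcase ?_
      rw [← h]; simp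
    obtain ⟨S, -, hS⟩ := Finset.exists_subset_card_eq
      (s := (Finset.univ : Finset (Fin G))) (n := min M G) (by simp)
    set T : Finset (User G g) := S.map ⟨fun i => (i, z), fun i j h => (Prod.ext_iff.1 h).1⟩ with hT
    have hTc : T.card = min M G := by rw [hT, Finset.card_map, hS]
    obtain ⟨p, hp, hlim⟩ := hmodel.exists_policy_zeroForcing hα hα1 (T := T)
      (hTc ▸ min_le_left _ _) (by
        intro k hk
        obtain ⟨i, -, rfl⟩ := Finset.mem_map.1 hk
        exact hz0)
    refine ⟨p, hp, _, hlim, ?_⟩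
    rw [max_eq_right (not_le.1 hcase).le, Finset.sum_ite_mem, Finset.univ_inter, Finset.sum_const,
      hTc, nsmul_eq_mul]

end Achievability

/-! ### The multiplexing gain -/

theorem proposition3 {Ω : Type*} [MeasurableSpace Ω] (μ : Measure Ω) [IsProbabilityMeasure μ]
    (M G g : ℕ) (hM : 1 ≤ M) (hG : 1 ≤ G) (hg : 2 ≤ g)
    (α : ℝ) (hα0 : 0 ≤ α) (hα1 : α ≤ 1)
    (H : Ω → UserVectors M G g) (Hhat : ℝ → Ω → UserVectors M G g)
    (hmodel : IsCSITModel μ α H Hhat) :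
    -- the maximal sum-rate is finite, and its pre-log factor is `max (1, min (M, G) α)`
    (∀ P : ℝ, 1 ≤ P → BddAbove (achievableSumRates μ H (Hhat P) P)) ∧
    Tendsto (fun P : ℝ => maxSumRate μ H (Hhat P) P / Real.logb 2 P) atTop
      (𝓝 (max 1 (((min M G : ℕ) : ℝ) * α))) ∧
    -- it is attained by precoders for which all individual multiplexing gains exist
    ∃ p : ℝ → UserVectors M G g → UserVectors M G g,
      (∀ P : ℝ, 1 ≤ P → IsPrecodingPolicy P (p P)) ∧
      ∃ d : User G g → ℝ,
        (∀ k, Tendsto (fun P : ℝ => userRate μ H (Hhat P) (p P) k / Real.logb 2 P) atTop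
          (𝓝 (d k))) ∧
        ∑ k, d k = max 1 (((min M G : ℕ) : ℝ) * α) := by
  have hg1 : 1 ≤ g := by omega
  have hbdd : ∀ P : ℝ, 1 ≤ P → BddAbove (achievableSumRates μ H (Hhat P) P) := fun P hP =>
    hmodel.bddAbove_achievableSumRates hg1 hP
  obtain ⟨p, hp, d, hd, hsum⟩ := hmodel.exists_policy_tendsto hM hG hg1 hα0 hα1
  refine ⟨hbdd, ?_, p, hp, d, hd, hsum⟩
  have hlow : Tendsto (fun P : ℝ => (∑ k, userRate μ H (Hhat P) (p P) k) / Real.logb 2 P) atTop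
      (𝓝 (max 1 (((min M G : ℕ) : ℝ) * α))) := by
    simp_rw [Finset.sum_div]
    rw [← hsum]
    exact tendsto_finsetSum _ fun k _ => hd k
  refine tendsto_order.2 ⟨fun a ha => ?_, fun a ha => ?_⟩
  · filter_upwards [hlow.eventually_const_lt ha, eventually_ge_atTop (1 : ℝ),
      tendsto_logb_two_atTop.eventually_gt_atTop 0] with P hPa hP hL
    refine hPa.trans_le ?_
    gcongr
    exact le_csSup (hbdd P hP) ⟨p P, hp P hP, rfl⟩
  · have hε : 0 < (a - max 1 (((min M G : ℕ) : ℝ) * α)) / 2 := by linarith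
    filter_upwards [hmodel.eventually_sum_userRate_le hM hG hg1 hα0 hε,
      eventually_ge_atTop (1 : ℝ), tendsto_logb_two_atTop.eventually_gt_atTop 0] with P hPle hP hL
    rw [div_lt_iff₀ hL]
    refine lt_of_le_of_lt (csSup_le ⟨_, p P, hp P hP, rfl⟩ ?_)
      (mul_lt_mul_of_pos_right
        (show max 1 (((min M G : ℕ) : ℝ) * α) + (a - max 1 (((min M G : ℕ) : ℝ) * α)) / 2 < a by
          linarith) hL)
    rintro r ⟨p', hp', rfl⟩
    exact hPle p' hp'
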